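/- Notation. $C_c^\infty(\mathbb R^2)$ is the space of real-valued smooth compactly supported functions on $\mathbb R^2$. $C_0^\infty(\mathbb T^2)$ is the space of real-valued smooth functions on $\mathbb R^2$ that are $1$-periodic in both variables and satisfy $\int_{[0,1]^2} g\,dx=0$. For $g\in C_0^\infty(\mathbb T^2)$ and $k\ge 0$, $\Delta^{-k}g\in C_0^\infty(\mathbb T^2)$ is the unique function $h\in C_0^\infty(\mathbb T^2)$ with $\Delta^k h=g$; equivalently, its Fourier coefficients at $n\in\mathbb Z^2\setminus\{0\}$ are $(-4\pi^2|n|^2)^{-k}\hat g(n)$. For an integer $\lambda\ge1$, $g_\lambda(x)=g(\lambda x)$. Further, $\|u\|_{W^{m,s}}=\sum_{j\le m}\|D^ju\|_{L^s}$, where $L^s(\mathbb T^2)$ norms are taken over $[0,1]^2$, and $\|u\|_{C^k(\mathbb R^2)}=\sum_{j\le k}\sup_{\mathbb R^2}|D^ju|$. Proposition (improved higher order inverse Laplacian). Let $N,M\ge 0$ be integers. There exist bilinear operators $$\mathcal B^N_M,\ \mathcal V^N_M:\ C_c^\infty(\mathbb R^2)\times C_0^\infty(\mathbb T^2)\to C_c^\infty(\mathbb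 R^2)$$ such that, for all $f\in C_c^\infty(\mathbb R^2)$ and $g\in C_0^\infty(\mathbb T^2)$: (i) $\Delta^N\mathcal B^N_M(f,g)=fg+\mathcal V^N_M(f,g)$. (ii) $\operatorname{supp}\mathcal B^N_M(f,g)\subseteq\operatorname{supp}f$ and $\operatorname{supp}\mathcal V^N_M(f,g)\subseteq\operatorname{supp}f$. (iii) Let $I\subseteq\mathbb R$ be a nondegenerate interval, and let $f,g$ be smooth functions on $I\times\mathbb R^2$ such that $f(t,\cdot),\partial_tf(t,\cdot)\in C_c^\infty(\mathbb R^2)$ and $g(t,\cdot),\partial_tg(t,\cdot)\in C_0^\infty(\mathbb T^2)$ for every $t\in I$. Then, pointwise on $I\times\mathbb R^2$ (with one-sided time derivatives at the endpoints of $I$ that belong to $I$), $$\partial_t\mathcal B^N_M(f,g)=\mathcal B^N_M(\partial_tf,g)+\mathcal B^N_M(f,\partial_tg),\qquad \partial_t\mathcal V^N_M(f,g)=\mathcal V^N_M(\partial_tf,g)+\mathcal V^N_M(f,\partial_tg).$$ (iv) For every integer $m\ge0$ there is a constant $C=C(N,M,m)$ such that for all $s\in[1,\infty]$, all $R\ge0$,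 all $f\in C_c^\infty(\mathbb R^2)$ supported in some closed ball of radius $R$, and all $g\in C_0^\infty(\mathbb T^2)$, $$\|\mathcal B^N_M(f,g)\|_{W^{m,s}(\mathbb R^2)}\le C(1+R)^{2/s}\|f\|_{C^{2NM+m}(\mathbb R^2)}\|\Delta^{-N}g\|_{W^{m,s}(\mathbb T^2)},$$ $$\|\mathcal V^N_M(f,g)\|_{W^{m,s}(\mathbb R^2)}\le C(1+R)^{2/s}\|f\|_{C^{2N(M+1)+m}(\mathbb R^2)}\cdot\begin{cases}\|\Delta^{-M/2}g\|_{W^{m,s}(\mathbb T^2)},&M\text{ even},\\ \|\Delta^{-(M+1)/2}g\|_{W^{m+1,s}(\mathbb T^2)},&M\text{ odd},\end{cases}$$ and, for every integer $\lambda\ge1$, $$\|\mathcal B^N_M(f,g_\lambda)\|_{W^{m,s}(\mathbb R^2)}\le C(1+R)^{2/s}\lambda^{-2N+m}\|f\|_{C^{2NM+m}(\mathbb R^2)}\|\Delta^{-N}g\|_{W^{m,s}(\mathbb T^2)},$$ $$\|\mathcal V^N_M(f,g_\lambda)\|_{W^{m,s}(\mathbb R^2)}\le C(1+R)^{2/s}\lambda^{-M+m}\|f\|_{C^{2N(M+1)+m}(\mathbb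 R^2)}\|g\|_{W^{m,s}(\mathbb T^2)}.$$ (For $s=\infty$ the factor $(1+R)^{2/s}$ is $1$.) -/

import Mathlib

open scoped ContDiff ENNReal NNReal

noncomputable section

/-- The Euclidean plane `ℝ²`. -/
abbrev Plane : Type := EuclideanSpace ℝ (Fin 2)

/-- The closed unit cell `[0,1]²`, over which integrals and `L^s` norms on `𝕋²` are taken. -/
def unitCell : Set Plane := {x | ∀ i, x i ∈ Set.Icc (0 : ℝ) 1}

theorem isCompact_unitCell : IsCompact unitCell := by
  have h : IsCompact (Set.pi Set.univ fun _ : Fin 2 => Set.Icc (0 : ℝ) 1) :=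
    isCompact_univ_pi fun _ => isCompact_Icc
  have h2 : unitCell = (EuclideanSpace.equiv (Fin 2) ℝ).symm ''
      (Set.pi Set.univ fun _ : Fin 2 => Set.Icc (0 : ℝ) 1) := by
    ext x
    rw [ContinuousLinearEquiv.image_symm_eq_preimage]
    simp only [unitCell, Set.mem_ofPred_eq, Set.mem_preimage, Set.mem_pi, Set.mem_univ,
      forall_true_left]
    rfl
  rw [h2]
  exact h.image (EuclideanSpace.equiv (Fin 2) ℝ).symm.continuous

/-- `C_c^∞(ℝ²)`: smooth compactly supported real functions. -/
def TestFun : Submodule ℝ (Plane → ℝ) where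
  carrier := {f | ContDiff ℝ ∞ f ∧ HasCompactSupport f}
  add_mem' := fun hf hg => ⟨hf.1.add hg.1, hf.2.add hg.2⟩
  zero_mem' := ⟨contDiff_const, HasCompactSupport.zero⟩
  smul_mem' := fun c _ hf => ⟨contDiff_const.smul hf.1, hf.2.smul_left (f := fun _ => c)⟩

/-- `C_0^∞(𝕋²)`: smooth functions on `ℝ²` with period `1` in both variables and with zero mean over
one periodic box. -/
def PeriodicMeanZero : Submodule ℝ (Plane → ℝ) where
  carrier := {g | ContDiff ℝ ∞ g ∧
    (∀ (x : Plane) (i : Fin 2) (l : ℤ), g (x + EuclideanSpace.single i (l : ℝ)) = g x) ∧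
    ∫ x in unitCell, g x = 0}
  add_mem' := by
    rintro f g ⟨hf, pf, mf⟩ ⟨hg, pg, mg⟩
    refine ⟨hf.add hg, fun x i l => ?_, ?_⟩
    · simp [pf x i l, pg x i l]
    · have h1 := hf.continuous.continuousOn.integrableOn_compact (μ := MeasureTheory.volume)
        isCompact_unitCell
      have h2 := hg.continuous.continuousOn.integrableOn_compact (μ := MeasureTheory.volume)
        isCompact_unitCell
      simp only [Pi.add_apply]
      rw [MeasureTheory.integral_add h1 h2, mf, mg, add_zero]
  zero_mem' := ⟨contDiff_const, fun _ _ _ => rfl, by simp⟩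
  smul_mem' := by
    rintro c g ⟨hg, pg, mg⟩
    refine ⟨contDiff_const.smul hg, fun x i l => ?_, ?_⟩
    · simp [pg x i l]
    · simp only [Pi.smul_apply, smul_eq_mul]
      rw [MeasureTheory.integral_const_mul, mg, mul_zero]

/-- The Laplacian `Δ` of a function on `ℝ²`; its iterate `lap^[N]` is `Δ^N`. -/
def lap (u : Plane → ℝ) : Plane → ℝ := Laplacian.laplacian u

/-- `Δ^{-k} g` for `g ∈ C_0^∞(𝕋²)`: the periodic function with zero mean whose Fourier coefficients
at the frequencies `n ∈ ℤ² ∖ {0}` are `(-4π²|n|²)^{-k}` times those of `g`. In real form, the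
frequency `n` contributes `(-4π²|n|²)^{-k} ∫_{[0,1]²} g(y) cos(2π n·(x-y)) dy`. -/
def invLap (k : ℕ) (g : Plane → ℝ) : Plane → ℝ := fun x =>
  ∑' n : ℤ × ℤ, if n = 0 then 0 else
    ((-(4 * Real.pi ^ 2 * ((n.1 : ℝ) ^ 2 + (n.2 : ℝ) ^ 2))) ^ k)⁻¹ *
      ∫ y in unitCell, g y *
        Real.cos (2 * Real.pi * ((n.1 : ℝ) * (x 0 - y 0) + (n.2 : ℝ) * (x 1 - y 1)))

/-- The Sobolev norm `∑_{j ≤ m} ‖D^j u‖_{L^s(Ω)}` of a smooth function `u` (all of whose weak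
derivatives are its classical ones). -/
def sobolevNorm (Ω : Set Plane) (m : ℕ) (s : ℝ≥0∞) (u : Plane → ℝ) : ℝ≥0∞ :=
  ∑ j ∈ Finset.range (m + 1),
    MeasureTheory.eLpNorm (fun x => iteratedFDeriv ℝ j u x) s (MeasureTheory.volume.restrict Ω)

/-- `‖u‖_{W^{m,s}(ℝ²)}`. -/
def sobolevNormPlane (m : ℕ) (s : ℝ≥0∞) (u : Plane → ℝ) : ℝ≥0∞ := sobolevNorm Set.univ m s u

/-- `‖u‖_{W^{m,s}(𝕋²)}` for a periodic `u`. -/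
def sobolevNormTorus (m : ℕ) (s : ℝ≥0∞) (u : Plane → ℝ) : ℝ≥0∞ := sobolevNorm unitCell m s u

/-- `‖u‖_{C^k(ℝ²)} = ∑_{j ≤ k} sup_x |D^j u(x)|`. -/
def cNorm (k : ℕ) (u : Plane → ℝ) : ℝ≥0∞ :=
  ∑ j ∈ Finset.range (k + 1), ⨆ x, ‖iteratedFDeriv ℝ j u x‖ₑ

/-- The oscillating function `g_λ(x) = g(λx)`. -/
def dilate (lam : ℕ) (g : Plane → ℝ) : Plane → ℝ := fun x => g ((lam : ℝ) • x)

/-- The integral over the unit cell as an iterated integral. -/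
theorem integral_unitCell {g : Plane → ℝ} (hg : Continuous g) :
    ∫ x in unitCell, g x = ∫ a in (0 : ℝ)..1, ∫ b in (0 : ℝ)..1, g (WithLp.toLp 2 ![a, b]) := by
  have e1 := (PiLp.volume_preserving_toLp (Fin 2)).setIntegral_preimage_emb
    (MeasurableEquiv.toLp 2 (Fin 2 → ℝ)).measurableEmbedding g unitCell
  have e2 := (MeasureTheory.volume_preserving_finTwoArrow ℝ).symm.setIntegral_preimage_emb
    (MeasurableEquiv.finTwoArrow (α := ℝ)).symm.measurableEmbedding
    (fun y : Fin 2 → ℝ => g (WithLp.toLp 2 y)) (WithLp.toLp 2 ⁻¹' unitCell)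
  have e3 : (MeasurableEquiv.finTwoArrow (α := ℝ)).symm ⁻¹' (WithLp.toLp 2 ⁻¹' unitCell) =
      Set.Icc (0 : ℝ) 1 ×ˢ Set.Icc (0 : ℝ) 1 := by
    ext p
    simp only [Set.mem_preimage, unitCell, Set.mem_ofPred_eq, Fin.forall_fin_two, Set.mem_prod]
    rfl
  rw [e3] at e2
  have hc : Continuous fun p : ℝ × ℝ => g (WithLp.toLp 2 ![p.1, p.2]) := by fun_prop
  rw [← e1, ← e2, MeasureTheory.Measure.volume_eq_prod, MeasureTheory.setIntegral_prod]
  · rw [intervalIntegral.integral_of_le zero_le_one, ← MeasureTheory.integral_Icc_eq_integral_Ioc]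
    refine MeasureTheory.integral_congr_ae (Filter.Eventually.of_forall fun a => ?_)
    simp only
    rw [intervalIntegral.integral_of_le zero_le_one, ← MeasureTheory.integral_Icc_eq_integral_Ioc]
    rfl
  · exact hc.continuousOn.integrableOn_compact (isCompact_Icc.prod isCompact_Icc)

/-- Dilation by a positive integer does not change the mean of a function of period `1`. -/
theorem intervalIntegral_dilate {h : ℝ → ℝ} (hc : Continuous h) (hp : Function.Periodic h 1)
    {lam : ℕ} (hl : 1 ≤ lam) :
    ∫ a in (0 : ℝ)..1, h (lam * a) = ∫ a in (0 : ℝ)..1, h a := by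
  have h0 : (lam : ℝ) ≠ 0 := by positivity
  have h1 := hp.intervalIntegral_add_zsmul_eq (lam : ℤ) 0
    (fun _ _ => hc.intervalIntegrable _ _)
  rw [intervalIntegral.integral_comp_mul_left h h0]
  simp only [zero_add, zsmul_eq_mul, Int.cast_natCast, mul_one] at h1
  simp [h1, h0]

theorem dilate_mem {g : Plane → ℝ} (hg : g ∈ PeriodicMeanZero) {lam : ℕ} (hl : 1 ≤ lam) :
    dilate lam g ∈ PeriodicMeanZero := by
  obtain ⟨hs, hp, hm⟩ := hg
  have hs' : ContDiff ℝ ∞ (dilate lam g) := hs.comp (contDiff_const_smul (lam : ℝ))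
  refine ⟨hs', fun x i l => ?_, ?_⟩
  · have h1 : (lam : ℝ) • (x + EuclideanSpace.single i (l : ℝ)) =
        (lam : ℝ) • x + EuclideanSpace.single i (((lam : ℤ) * l : ℤ) : ℝ) := by
      ext j
      by_cases hj : j = i <;> simp [hj]
    simp only [dilate]
    rw [h1, hp]
  · have p1 (b : ℝ) : Function.Periodic (fun a => g (WithLp.toLp 2 ![a, b])) 1 := fun a => by
      have h1 : (WithLp.toLp 2 ![a + 1, b] : Plane) =
          WithLp.toLp 2 ![a, b] + EuclideanSpace.single 0 ((1 : ℤ) : ℝ) := by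
        ext j; fin_cases j <;> simp
      simp only
      rw [h1, hp]
    have p2 (a : ℝ) : Function.Periodic (fun b => g (WithLp.toLp 2 ![a, b])) 1 := fun b => by
      have h1 : (WithLp.toLp 2 ![a, b + 1] : Plane) =
          WithLp.toLp 2 ![a, b] + EuclideanSpace.single 1 ((1 : ℤ) : ℝ) := by
        ext j; fin_cases j <;> simp
      simp only
      rw [h1, hp]
    have hc := hs.continuous
    have c2 (a : ℝ) : Continuous fun b => g (WithLp.toLp 2 ![a, b]) := by fun_prop
    have c1 : Continuous fun a : ℝ => ∫ b in (0 : ℝ)..1, g (WithLp.toLp 2 ![a, b]) :=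
      intervalIntegral.continuous_parametric_intervalIntegral_of_continuous'
        (by simp only [Function.uncurry_def]; fun_prop) 0 1
    have e (a b : ℝ) : dilate lam g (WithLp.toLp 2 ![a, b]) =
        g (WithLp.toLp 2 ![lam * a, lam * b]) := by
      simp only [dilate]
      congr 1
      ext j; fin_cases j <;> simp
    rw [integral_unitCell hs.continuous] at hm
    rw [integral_unitCell hs'.continuous]
    simp only [e]
    simp_rw [fun a => intervalIntegral_dilate (c2 a) (p2 a) hl]
    refine Eq.trans ?_ hm
    exact intervalIntegral_dilate c1
      (fun a => by
        simp only
        exact intervalIntegral.integral_congr fun b _ => p1 b a) hl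

/-- `g_λ` as an element of `C_0^∞(𝕋²)`, for a positive integer `λ`. -/
def osc (lam : ℕ) (hl : 1 ≤ lam) (g : PeriodicMeanZero) : PeriodicMeanZero :=
  ⟨dilate lam g, dilate_mem g.2 hl⟩

end

/-!
The operators are real combinations of the elementary bilinear operators
`(f, g) ↦ ∂^a f · ∂^b Δ^{-k} g` (`elem a b k`), which are local in `f`. Two facts carry the proof.

*The algebra.* By the Leibniz rule, `Δ^N (∂^a f · ∂^b Δ^{-k-N} g)` is `∂^a f · ∂^b Δ^{-k} g` plus
elementary operators in which at least one derivative has moved from the periodic factor to `f`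
(`exists_postLap_pow_elem`). Starting from `f · Δ^{-N} g`, whose image under `Δ^N` is `f g` up to
such an error, and subtracting an approximate preimage of the error, each correction lowers the
order of the error in `g` by one. After `M` corrections every term of the error has the form
`∂^a f · ∂^b Δ^{-N(M+1)} g` with `|b| < 2N(M+1) - M`, so that it has order less than `-M` in `g`
(`exists_bilinear_operators`).

*The analysis.* An operator `∂^w Δ^{-L}` of negative order, `|w| < 2L`, is an average of translates
against an integrable kernel (`exists_average`). Such an average is bounded on `L^s(𝕋²)` for all
`1 ≤ s ≤ ∞` at once, by Jensen's inequality, so the endpoints need no separate theory and the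
constants do not depend on `s`. The kernel comes from writing the symbol as an integral over scales:
with a cutoff `χ` supported in `(0, 1)`, and since nonzero frequencies have length at least `1`,
`|n|^{-2L}` is a multiple of `∫₀¹ r^{2L-1} χ(r² |n|²) dr`; multiplying by the symbol of `∂^w` gives
`r^{2L-1-|w|}` times a fixed compactly supported smooth multiplier evaluated at `r n`, that is,
convolution with a rescaled Schwartz function, and the power of `r` is integrable on `(0, 1)`
exactly because the order is negative.

Relative to `Δ^{-M/2} g` the error has negative order when `M` is even; relative to
`Δ^{-(M+1)/2} g` it may have order zero when `M` is odd, and then one derivative is moved onto the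
periodic function, which is the reason for the `W^{m+1,s}` norm in that case. A periodic
function on a ball of radius `R` is controlled by `O((1 + R)²)` copies of the unit cell
(`eLpNorm_closedBall_le`), which gives the factor `(1 + R)^{2/s}`. For oscillating `g`, the relation
`Δ^{-k} g_λ = λ^{-2k} (Δ^{-k} g)_λ` (`invPow_osc`) supplies the powers of `λ`. Finally, operators of
negative order are bounded for the supremum norm, and difference quotients in time of a smooth
periodic family converge uniformly in space, so these operators commute with the time derivative
(`hasDerivWithinAt_pdsP_invPow`).
-/

/-! ### Partial derivatives -/

/-- The `i`-th standard basis vector of the plane. -/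
noncomputable abbrev basisVec (i : Fin 2) : Plane := EuclideanSpace.single i (1 : ℝ)

/-- The partial derivative `∂_i u`. -/
noncomputable def pd {E : Type*} [NormedAddCommGroup E] [NormedSpace ℝ E] (i : Fin 2)
    (u : Plane → E) : Plane → E :=
  fun x => fderiv ℝ u x (basisVec i)

/-- The iterated partial derivative `∂_{i₁} ⋯ ∂_{i_k} u` along a word `w = [i₁, …, i_k]`. -/
noncomputable def pds (w : List (Fin 2)) (u : Plane → ℝ) : Plane → ℝ := w.foldr pd u

/-- Functions on the plane with period `1` in both variables. -/
def LatticePeriodic {α : Type*} (u : Plane → α) : Prop :=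
  ∀ (x : Plane) (i : Fin 2) (l : ℤ), u (x + EuclideanSpace.single i (l : ℝ)) = u x

section pd

variable {E : Type*} [NormedAddCommGroup E] [NormedSpace ℝ E]

theorem ContDiff.pd {u : Plane → E} (hu : ContDiff ℝ ∞ u) (i : Fin 2) :
    ContDiff ℝ ∞ (pd i u) :=
  (contDiff_infty_iff_fderiv.1 hu).2.clm_apply contDiff_const

theorem ContDiff.differentiableAt_of_infty {u : Plane → E} (hu : ContDiff ℝ ∞ u) (x : Plane) :
    DifferentiableAt ℝ u x :=
  (hu.differentiable (by simp)) x

theorem ContDiff.pds {u : Plane → ℝ} (hu : ContDiff ℝ ∞ u) (w : List (Fin 2)) :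
    ContDiff ℝ ∞ (pds w u) := by
  induction w with
  | nil => exact hu
  | cons i w ih => exact ih.pd i

@[simp] theorem pds_nil (u : Plane → ℝ) : pds [] u = u := rfl

@[simp] theorem pds_cons (i : Fin 2) (w : List (Fin 2)) (u : Plane → ℝ) :
    pds (i :: w) u = pd i (pds w u) := rfl

theorem pd_add {u v : Plane → E} (hu : ContDiff ℝ ∞ u) (hv : ContDiff ℝ ∞ v) (i : Fin 2) :
    pd i (u + v) = pd i u + pd i v := by
  funext x
  simp only [pd]
  rw [fderiv_add (hu.differentiableAt_of_infty x) (hv.differentiableAt_of_infty x)]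
  rfl

theorem pd_const_smul {u : Plane → E} (hu : ContDiff ℝ ∞ u) (c : ℝ) (i : Fin 2) :
    pd i (c • u) = c • pd i u := by
  funext x
  simp only [pd]
  rw [fderiv_const_smul (hu.differentiableAt_of_infty x)]
  rfl

theorem pd_mul {u v : Plane → ℝ} (hu : ContDiff ℝ ∞ u) (hv : ContDiff ℝ ∞ v) (i : Fin 2) :
    pd i (u * v) = pd i u * v + u * pd i v := by
  funext x
  simp only [pd]
  rw [fderiv_mul (hu.differentiableAt_of_infty x) (hv.differentiableAt_of_infty x)]
  simp only [add_apply, smul_apply, smul_eq_mul, Pi.add_apply, Pi.mul_apply, pd]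
  ring

theorem pd_pd_eq {u : Plane → E} (hu : ContDiff ℝ ∞ u) (i j : Fin 2) (x : Plane) :
    pd i (pd j u) x = fderiv ℝ (fderiv ℝ u) x (basisVec i) (basisVec j) := by
  have h : DifferentiableAt ℝ (fderiv ℝ u) x :=
    ((contDiff_infty_iff_fderiv.1 hu).2).differentiable (by simp) x
  unfold pd
  rw [fderiv_clm_apply h (differentiableAt_const _)]
  simp

theorem pd_comm {u : Plane → E} (hu : ContDiff ℝ ∞ u) (i j : Fin 2) :
    pd i (pd j u) = pd j (pd i u) := by
  funext x
  rw [pd_pd_eq hu, pd_pd_eq hu]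
  exact (hu.contDiffAt (x := x)).isSymmSndFDerivAt
    (by rw [minSmoothness_of_isRCLikeNormedField]; exact ENat.LEInfty.out) _ _

theorem lap_eq {u : Plane → ℝ} (hu : ContDiff ℝ ∞ u) : lap u = ∑ i, pd i (pd i u) := by
  funext x
  unfold lap
  rw [InnerProductSpace.laplacian_eq_iteratedFDeriv_orthonormalBasis u
    (EuclideanSpace.basisFun (Fin 2) ℝ)]
  simp only [Finset.sum_apply]
  refine Finset.sum_congr rfl fun i _ => ?_
  rw [pd_pd_eq hu, iteratedFDeriv_two_apply]
  simp

theorem ContDiff.lap {u : Plane → ℝ} (hu : ContDiff ℝ ∞ u) : ContDiff ℝ ∞ (lap u) := by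
  rw [lap_eq hu]
  have h := ContDiff.sum (𝕜 := ℝ) (s := Finset.univ) (f := fun i => _root_.pd i (_root_.pd i u))
    (n := ∞) fun i _ => (hu.pd i).pd i
  convert h using 1
  funext x
  simp

theorem LatticePeriodic.fderiv {u : Plane → E} (hu : LatticePeriodic u) :
    LatticePeriodic (fderiv ℝ u) := by
  intro x i l
  rw [← fderiv_comp_add_right]
  congr 1
  funext y
  exact hu y i l

theorem LatticePeriodic.pd {u : Plane → E} (hu : LatticePeriodic u) (i : Fin 2) :
    LatticePeriodic (pd i u) := by
  intro x j l
  simp only [_root_.pd]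
  rw [hu.fderiv x j l]

theorem LatticePeriodic.iteratedFDeriv {u : Plane → E} (hu : LatticePeriodic u) (n : ℕ) :
    LatticePeriodic (iteratedFDeriv ℝ n u) := by
  intro x i l
  rw [← iteratedFDeriv_comp_add_right]
  congr 1
  funext y
  exact hu y i l

/-- A periodic function is invariant under all translations by lattice vectors. -/
theorem LatticePeriodic.add_lattice {α : Type*} {u : Plane → α} (hu : LatticePeriodic u)
    (x : Plane) (n : Fin 2 → ℤ) : u (x + WithLp.toLp 2 fun i => (n i : ℝ)) = u x := by
  have h : (WithLp.toLp 2 fun i => (n i : ℝ) : Plane) =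
      EuclideanSpace.single 0 (n 0 : ℝ) + EuclideanSpace.single 1 (n 1 : ℝ) := by
    ext j; fin_cases j <;> simp
  rw [h, ← add_assoc, hu, hu]

theorem tsupport_pd_subset (u : Plane → E) (i : Fin 2) : tsupport (pd i u) ⊆ tsupport u :=
  tsupport_fderiv_apply_subset ℝ _

end pd

theorem tsupport_pds_subset (u : Plane → ℝ) (w : List (Fin 2)) :
    tsupport (pds w u) ⊆ tsupport u := by
  induction w with
  | nil => exact subset_rfl
  | cons i w ih => exact (tsupport_pd_subset _ i).trans ih

/-- The norm of the differential is controlled by the partial derivatives. -/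
theorem norm_iteratedFDeriv_succ_le {u : Plane → ℝ} (hu : ContDiff ℝ ∞ u) (n : ℕ) (x : Plane) :
    ‖iteratedFDeriv ℝ (n + 1) u x‖ ≤ ∑ i, ‖iteratedFDeriv ℝ n (pd i u) x‖ := by
  set L : Fin 2 → Plane →L[ℝ] ℝ := fun i => EuclideanSpace.proj i
  have hL (i : Fin 2) : ‖L i‖ ≤ 1 :=
    ContinuousLinearMap.opNorm_le_bound _ zero_le_one fun y => by
      simpa [L] using PiLp.norm_apply_le y i
  have h1 : fderiv ℝ u = fun y =>
      ∑ i, (ContinuousLinearMap.toSpanSingleton ℝ (L i)) (pd i u y) := by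
    funext y
    ext z
    have hz : z = ∑ i, z i • basisVec i := by
      ext j; fin_cases j <;> simp
    conv_lhs => rw [hz]
    simp only [map_sum, map_smul, ContinuousLinearMap.toSpanSingleton_apply,
      sum_apply, smul_apply, smul_eq_mul, L, pd]
    refine Finset.sum_congr rfl fun i _ => ?_
    rw [mul_comm]; rfl
  rw [← norm_iteratedFDeriv_fderiv, h1]
  have hc (i : Fin 2) : ContDiff ℝ ∞ fun y =>
      (ContinuousLinearMap.toSpanSingleton ℝ (L i)) (pd i u y) :=
    (ContinuousLinearMap.toSpanSingleton ℝ (L i)).contDiff.comp (hu.pd i)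
  rw [iteratedFDeriv_fun_sum_apply fun i _ => ((hc i).of_le (mod_cast le_top)).contDiffAt]
  refine (norm_sum_le _ _).trans (Finset.sum_le_sum fun i _ => ?_)
  have := (ContinuousLinearMap.toSpanSingleton ℝ (L i)).norm_iteratedFDeriv_comp_left
    ((hu.pd i).contDiffAt (x := x)) (N := ∞) (n := n) (mod_cast le_top)
  refine this.trans ?_
  rw [ContinuousLinearMap.norm_toSpanSingleton]
  exact mul_le_of_le_one_left (norm_nonneg _) (hL i)

theorem norm_iteratedFDeriv_pd_le {u : Plane → ℝ} (hu : ContDiff ℝ ∞ u) (i : Fin 2) (n : ℕ)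
    (x : Plane) : ‖iteratedFDeriv ℝ n (pd i u) x‖ ≤ ‖iteratedFDeriv ℝ (n + 1) u x‖ := by
  rw [← norm_iteratedFDeriv_fderiv]
  have := (ContinuousLinearMap.apply ℝ ℝ (basisVec i)).norm_iteratedFDeriv_comp_left
    ((contDiff_infty_iff_fderiv.1 hu).2.contDiffAt (x := x)) (N := ∞) (n := n) (mod_cast le_top)
  refine this.trans (mul_le_of_le_one_left (norm_nonneg _) ?_)
  refine ContinuousLinearMap.opNorm_le_bound _ zero_le_one fun y => ?_
  simpa using y.le_opNorm (basisVec i)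

theorem norm_iteratedFDeriv_pds_le {u : Plane → ℝ} (hu : ContDiff ℝ ∞ u) (w : List (Fin 2))
    (n : ℕ) (x : Plane) :
    ‖iteratedFDeriv ℝ n (pds w u) x‖ ≤ ‖iteratedFDeriv ℝ (n + w.length) u x‖ := by
  induction w generalizing n with
  | nil => exact le_rfl
  | cons i w ih =>
    refine (norm_iteratedFDeriv_pd_le (hu.pds w) i n x).trans ((ih (n + 1)).trans_eq ?_)
    rw [List.length_cons, add_right_comm, add_assoc]

/-! ### Integrals of periodic functions -/

/-- The half-open cell of side `k` with lower corner `a`. -/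
def latticeBox (a : Fin 2 → ℝ) (k : ℕ) : Set Plane := {x | ∀ i, x i ∈ Set.Ioc (a i) (a i + k)}

theorem measurableSet_latticeBox (a : Fin 2 → ℝ) (k : ℕ) : MeasurableSet (latticeBox a k) := by
  have : latticeBox a k = ⋂ i, (fun x : Plane => x i) ⁻¹' Set.Ioc (a i) (a i + k) := by
    ext x; simp [latticeBox]
  rw [this]
  refine MeasurableSet.iInter fun i => measurableSet_Ioc.preimage ?_
  exact (EuclideanSpace.proj (𝕜 := ℝ) i).continuous.measurable

theorem measurableSet_unitCell : MeasurableSet unitCell := isCompact_unitCell.measurableSet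

theorem unitCell_ae_eq_latticeBox :
    unitCell =ᵐ[MeasureTheory.volume] latticeBox 0 1 := by
  have h := MeasureTheory.Measure.univ_pi_Ioc_ae_eq_Icc
    (μ := fun _ : Fin 2 => (MeasureTheory.volume : MeasureTheory.Measure ℝ)) (f := 0) (g := 1)
  have h2 := (PiLp.volume_preserving_ofLp (Fin 2)).quasiMeasurePreserving.preimage_ae_eq h
  have e1 : WithLp.ofLp ⁻¹' (Set.Icc (0 : Fin 2 → ℝ) 1) = unitCell := by
    ext x
    simp only [Set.mem_preimage, unitCell, Set.mem_ofPred_eq, Set.mem_Icc, Pi.le_def, forall_and]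
    rfl
  have e2 : WithLp.ofLp ⁻¹' (Set.pi Set.univ fun i => Set.Ioc ((0 : Fin 2 → ℝ) i)
      ((1 : Fin 2 → ℝ) i)) = latticeBox 0 1 := by
    ext x
    simp [latticeBox]
  rw [← e1, ← e2]
  exact h2.symm

/-- The function on the torus induced by a function on the plane, through arbitrary representatives
of the points of the torus; it is the expected one if `u` is periodic. -/
noncomputable def toTorus {α : Type*} (u : Plane → α) (t : UnitAddTorus (Fin 2)) : α :=
  u (WithLp.toLp 2 fun i => Quotient.out (t i))

theorem toTorus_coe {α : Type*} {u : Plane → α} (hu : LatticePeriodic u) (x : Fin 2 → ℝ) :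
    toTorus u (fun i => (x i : UnitAddCircle)) = u (WithLp.toLp 2 x) := by
  have h (i : Fin 2) : ∃ l : ℤ, Quotient.out (x i : UnitAddCircle) = x i + l := by
    have h1 : ((Quotient.out (x i : UnitAddCircle) : ℝ) : UnitAddCircle) = x i :=
      Quotient.out_eq _
    rw [← sub_eq_zero, ← AddCircle.coe_sub, AddCircle.coe_eq_zero_iff] at h1
    obtain ⟨l, hl⟩ := h1
    exact ⟨l, by rw [zsmul_one] at hl; rw [hl]; ring⟩
  choose l hl using h
  rw [toTorus, ← hu.add_lattice (WithLp.toLp 2 x) l]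
  congr 1
  ext i
  simp [hl]

theorem lintegral_latticeBox {F : Plane → ℝ≥0∞} (hF : LatticePeriodic F) (a : Fin 2 → ℝ) :
    ∫⁻ x in latticeBox a 1, F x = ∫⁻ x in unitCell, F x := by
  have key (b : Fin 2 → ℝ) : ∫⁻ x in latticeBox b 1, F x =
      ∫⁻ (x : Fin 2 → ℝ) in {x : Fin 2 → ℝ | ∀ i, x i ∈ Set.Ioc (b i) (b i + 1)},
        toTorus F (fun i => x i) := by
    have e := (PiLp.volume_preserving_toLp (Fin 2)).setLIntegral_comp_preimage_emb
      (MeasurableEquiv.toLp 2 (Fin 2 → ℝ)).measurableEmbedding F (latticeBox b 1)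
    rw [← e]
    simp only [toTorus_coe hF]
    congr 2
    ext x
    simp [latticeBox]
  rw [MeasureTheory.setLIntegral_congr unitCell_ae_eq_latticeBox, key, key,
    ← UnitAddTorus.lintegral_preimage, ← UnitAddTorus.lintegral_preimage]

theorem integral_latticeBox {E : Type*} [NormedAddCommGroup E] [NormedSpace ℝ E] {F : Plane → E}
    (hF : LatticePeriodic F) (a : Fin 2 → ℝ) :
    ∫ x in latticeBox a 1, F x = ∫ x in unitCell, F x := by
  have key (b : Fin 2 → ℝ) : ∫ x in latticeBox b 1, F x =
      ∫ (x : Fin 2 → ℝ) in {x : Fin 2 → ℝ | ∀ i, x i ∈ Set.Ioc (b i) (b i + 1)},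
        toTorus F (fun i => x i) := by
    have e := (PiLp.volume_preserving_toLp (Fin 2)).setIntegral_preimage_emb
      (MeasurableEquiv.toLp 2 (Fin 2 → ℝ)).measurableEmbedding F (latticeBox b 1)
    rw [← e]
    simp only [toTorus_coe hF]
    congr 2
    ext x
    simp [latticeBox]
  rw [MeasureTheory.setIntegral_congr_set unitCell_ae_eq_latticeBox, key, key,
    ← UnitAddTorus.integral_preimage, ← UnitAddTorus.integral_preimage]

/-- Translating a periodic function does not change its integral over a period. -/
theorem lintegral_unitCell_add {F : Plane → ℝ≥0∞} (hF : LatticePeriodic F) (v : Plane) :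
    ∫⁻ x in unitCell, F (x + v) = ∫⁻ x in unitCell, F x := by
  have e := (MeasureTheory.measurePreserving_add_right MeasureTheory.volume v
    ).setLIntegral_comp_preimage_emb (MeasurableEquiv.addRight v).measurableEmbedding F
      (latticeBox (fun i => v i) 1)
  rw [lintegral_latticeBox hF] at e
  rw [← e, MeasureTheory.setLIntegral_congr unitCell_ae_eq_latticeBox]
  congr 2
  ext x
  simp only [latticeBox, Set.mem_ofPred_eq, Set.mem_preimage, Set.mem_Ioc, PiLp.add_apply,
    Pi.zero_apply]
  refine forall_congr' fun i => and_congr ?_ ?_ <;> constructor <;> intro h <;> push_cast at * <;>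
    linarith

theorem integral_unitCell_add {E : Type*} [NormedAddCommGroup E] [NormedSpace ℝ E] {F : Plane → E}
    (hF : LatticePeriodic F) (v : Plane) :
    ∫ x in unitCell, F (x + v) = ∫ x in unitCell, F x := by
  have e := (MeasureTheory.measurePreserving_add_right MeasureTheory.volume v
    ).setIntegral_preimage_emb (MeasurableEquiv.addRight v).measurableEmbedding F
      (latticeBox (fun i => v i) 1)
  rw [integral_latticeBox hF] at e
  rw [← e, MeasureTheory.setIntegral_congr_set unitCell_ae_eq_latticeBox]
  congr 2
  ext x
  simp only [latticeBox, Set.mem_ofPred_eq, Set.mem_preimage, Set.mem_Ioc, PiLp.add_apply,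
    Pi.zero_apply]
  refine forall_congr' fun i => and_congr ?_ ?_ <;> constructor <;> intro h <;> push_cast at * <;>
    linarith

/-- A cell of side `k` is covered by `k²` unit cells. -/
theorem lintegral_latticeBox_le {F : Plane → ℝ≥0∞} (hF : LatticePeriodic F) (a : Fin 2 → ℝ)
    (k : ℕ) : ∫⁻ x in latticeBox a k, F x ≤ (k : ℝ≥0∞) ^ 2 * ∫⁻ x in unitCell, F x := by
  have hcov : latticeBox a k ⊆ ⋃ p : Fin 2 → Fin k, latticeBox (fun i => a i + (p i : ℕ)) 1 := by
    intro x hx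
    have h (i : Fin 2) : ∃ j : Fin k, x i ∈ Set.Ioc (a i + (j : ℕ)) (a i + (j : ℕ) + 1) := by
      obtain ⟨h1, h2⟩ := hx i
      have hpos : 0 < ⌈x i - a i⌉₊ := Nat.ceil_pos.2 (by linarith)
      have hle : ⌈x i - a i⌉₊ ≤ k := Nat.ceil_le.2 (by linarith)
      refine ⟨⟨⌈x i - a i⌉₊ - 1, by omega⟩, ?_, ?_⟩
      · have := Nat.ceil_lt_add_one (a := x i - a i) (by linarith)
        simp only [Nat.cast_sub (Nat.one_le_iff_ne_zero.2 hpos.ne')]; push_cast; linarith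
      · have := Nat.le_ceil (x i - a i)
        simp only [Nat.cast_sub (Nat.one_le_iff_ne_zero.2 hpos.ne')]; push_cast; linarith
    choose j hj using h
    exact Set.mem_iUnion.2 ⟨j, fun i => by simpa using hj i⟩
  calc ∫⁻ x in latticeBox a k, F x
      ≤ ∫⁻ x in ⋃ p : Fin 2 → Fin k, latticeBox (fun i => a i + (p i : ℕ)) 1, F x :=
        MeasureTheory.lintegral_mono_set hcov
    _ ≤ ∑' p : Fin 2 → Fin k, ∫⁻ x in latticeBox (fun i => a i + (p i : ℕ)) 1, F x :=
        MeasureTheory.lintegral_iUnion_le _ _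
    _ = (k : ℝ≥0∞) ^ 2 * ∫⁻ x in unitCell, F x := by
        simp only [lintegral_latticeBox hF, tsum_fintype, Finset.sum_const, Finset.card_univ,
          Fintype.card_pi, Fintype.card_fin, Finset.prod_const, nsmul_eq_mul]
        push_cast; ring

/-- A ball of radius `R` is covered by at most `9 (1 + R)²` unit cells. -/
theorem lintegral_closedBall_le {F : Plane → ℝ≥0∞} (hF : LatticePeriodic F) (x₀ : Plane) {R : ℝ}
    (hR : 0 ≤ R) : ∫⁻ x in Metric.closedBall x₀ R, F x ≤
      9 * ENNReal.ofReal (1 + R) ^ 2 * ∫⁻ x in unitCell, F x := by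
  set k := ⌈2 * R⌉₊ + 1
  have hk1 : (k : ℝ) ≤ 3 * (1 + R) := by
    have := Nat.ceil_lt_add_one (a := 2 * R) (by linarith)
    simp only [k]; push_cast; linarith
  have hk2 : 2 * R + 1 ≤ (k : ℝ) := by
    have := Nat.le_ceil (2 * R)
    simp only [k]; push_cast; linarith
  have hsub : Metric.closedBall x₀ R ⊆ latticeBox (fun i => x₀ i - R - 1 / 2) k := by
    intro x hx i
    have h1 : |x i - x₀ i| ≤ R := by
      have h2 := PiLp.norm_apply_le (x - x₀) i
      rw [mem_closedBall_iff_norm] at hx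
      simpa using h2.trans hx
    rw [abs_le] at h1
    constructor <;> linarith
  have hk3 : (k : ℝ≥0∞) ≤ 3 * ENNReal.ofReal (1 + R) := by
    rw [← ENNReal.ofReal_natCast, show (3 : ℝ≥0∞) = ENNReal.ofReal 3 by simp,
      ← ENNReal.ofReal_mul (by norm_num)]
    exact ENNReal.ofReal_le_ofReal hk1
  calc _ ≤ _ := MeasureTheory.lintegral_mono_set hsub
    _ ≤ _ := lintegral_latticeBox_le hF _ _
    _ ≤ (3 * ENNReal.ofReal (1 + R)) ^ 2 * ∫⁻ x in unitCell, F x := by gcongr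
    _ = _ := by rw [mul_pow]; norm_num

/-- Dilation by a positive integer does not increase the integral of a periodic function over a
period. -/
theorem lintegral_unitCell_dilate_le {F : Plane → ℝ≥0∞} (hF : LatticePeriodic F) {lam : ℕ}
    (hl : 1 ≤ lam) : ∫⁻ x in unitCell, F ((lam : ℝ) • x) ≤ ∫⁻ x in unitCell, F x := by
  have h0 : (lam : ℝ) ≠ 0 := by positivity
  have hpre : latticeBox 0 1 = (fun x : Plane => (lam : ℝ) • x) ⁻¹' latticeBox 0 lam := by
    ext x
    have hp : (0 : ℝ) < lam := by positivity
    simp only [latticeBox, Set.mem_ofPred_eq, Set.mem_preimage, Set.mem_Ioc, PiLp.smul_apply,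
      Pi.zero_apply, smul_eq_mul, zero_add, Nat.cast_one]
    refine forall_congr' fun i => and_congr ?_ ?_
    · simp [hp]
    · constructor <;> intro h <;> nlinarith
  have hemb : MeasurableEmbedding (fun x : Plane => (lam : ℝ) • x) :=
    (Homeomorph.smulOfNeZero (lam : ℝ) h0).measurableEmbedding
  have e : ∫⁻ x in latticeBox 0 1, F ((lam : ℝ) • x) =
      ((lam : ℝ≥0∞) ^ 2)⁻¹ * ∫⁻ x in latticeBox 0 lam, F x := by
    rw [hpre, ← hemb.lintegral_map, ← hemb.restrict_map,
      MeasureTheory.Measure.map_addHaar_smul _ h0, MeasureTheory.Measure.restrict_smul,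
      MeasureTheory.lintegral_smul_measure, smul_eq_mul]
    congr 1
    rw [finrank_euclideanSpace_fin, abs_of_nonneg (by positivity),
      ENNReal.ofReal_inv_of_pos (by positivity), ENNReal.ofReal_pow (by positivity),
      ENNReal.ofReal_natCast]
  rw [MeasureTheory.setLIntegral_congr unitCell_ae_eq_latticeBox, e]
  have hne : (lam : ℝ≥0∞) ^ 2 ≠ 0 := by positivity
  calc _ ≤ ((lam : ℝ≥0∞) ^ 2)⁻¹ * ((lam : ℝ≥0∞) ^ 2 * ∫⁻ x in unitCell, F x) := by
        gcongr; exact lintegral_latticeBox_le hF _ _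
    _ = _ := by rw [← mul_assoc, ENNReal.inv_mul_cancel hne (by finiteness), one_mul]

/-! ### Fourier series of smooth periodic functions -/

/-- The frequency `n ∈ ℤ²` as a vector of the plane. -/
noncomputable def freq (n : Fin 2 → ℤ) : Plane := WithLp.toLp 2 fun i => (n i : ℝ)

/-- The exponential `x ↦ exp (2πi ξ·x)`. -/
noncomputable def expo (ξ x : Plane) : ℂ :=
  Complex.exp (((2 * Real.pi * inner ℝ ξ x : ℝ) : ℂ) * Complex.I)

/-- The symbol `2πi n_i` of the partial derivative `∂_i`. -/
noncomputable def dsym (i : Fin 2) (n : Fin 2 → ℤ) : ℂ := 2 * Real.pi * Complex.I * (n i : ℂ)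

/-- The squared Euclidean length `|n|²` of a frequency. -/
noncomputable def freqSq (n : Fin 2 → ℤ) : ℝ := (n 0 : ℝ) ^ 2 + (n 1 : ℝ) ^ 2

/-- The Fourier coefficient of a real function at the frequency `n`. -/
noncomputable def coef (u : Plane → ℝ) (n : Fin 2 → ℤ) : ℂ :=
  ∫ y in unitCell, (u y : ℂ) * expo (-freq n) y

/-- Families of coefficients decaying faster than any power of the frequency. -/
def Rapid (a : (Fin 2 → ℤ) → ℂ) : Prop :=
  ∀ j : ℕ, Summable fun n => (1 + ‖n‖) ^ j * ‖a n‖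

/-- The trigonometric series with coefficients `a`. -/
noncomputable def trig (a : (Fin 2 → ℤ) → ℂ) (x : Plane) : ℂ := ∑' n, a n * expo (freq n) x

@[simp] theorem norm_expo (ξ x : Plane) : ‖expo ξ x‖ = 1 := Complex.norm_exp_ofReal_mul_I _

theorem expo_add (ξ x y : Plane) : expo ξ (x + y) = expo ξ x * expo ξ y := by
  simp only [expo, ← Complex.exp_add, inner_add_right]
  congr 1; push_cast; ring

theorem expo_neg_left (ξ x : Plane) : expo (-ξ) x = expo ξ (-x) := by
  simp [expo]

theorem latticePeriodic_expo (n : Fin 2 → ℤ) : LatticePeriodic (expo (freq n)) := by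
  intro x i l
  rw [expo_add]
  have : expo (freq n) (EuclideanSpace.single i (l : ℝ)) = 1 := by
    rw [expo, Complex.exp_eq_one_iff]
    refine ⟨n i * l, ?_⟩
    simp [freq, EuclideanSpace.inner_single_right]
    ring
  rw [this, mul_one]

theorem neg_freq (n : Fin 2 → ℤ) : -freq n = freq (-n) := by
  ext i; simp [freq]

/-- The differential of `expo ξ` at `x`. -/
noncomputable def expoDeriv (ξ x : Plane) : Plane →L[ℝ] ℂ :=
  (expo ξ x * (2 * Real.pi * Complex.I)) • (Complex.ofRealCLM.comp (innerSL ℝ ξ))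

theorem hasFDerivAt_expo (ξ x : Plane) : HasFDerivAt (expo ξ) (expoDeriv ξ x) x := by
  have h1 : HasFDerivAt (fun x : Plane => ((2 * Real.pi * inner ℝ ξ x : ℝ) : ℂ) * Complex.I)
      ((2 * Real.pi * Complex.I) • (Complex.ofRealCLM.comp (innerSL ℝ ξ))) x := by
    have h2 := ((2 * Real.pi * Complex.I : ℂ) •
      (Complex.ofRealCLM.comp (innerSL ℝ ξ))).hasFDerivAt (x := x)
    convert h2 using 1
    funext y
    simp
    ring
  have h3 := h1.cexp
  rw [smul_smul] at h3
  exact h3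

theorem contDiff_expo (ξ : Plane) : ContDiff ℝ ∞ (expo ξ) := by
  have h : ContDiff ℝ ∞ fun x : Plane => ((2 * Real.pi * inner ℝ ξ x : ℝ) : ℂ) :=
    Complex.ofRealCLM.contDiff.comp (contDiff_const.mul (contDiff_const.inner ℝ contDiff_id))
  exact (h.mul contDiff_const).cexp

theorem norm_expoDeriv_le (ξ x : Plane) : ‖expoDeriv ξ x‖ ≤ 2 * Real.pi * ‖ξ‖ := by
  refine ContinuousLinearMap.opNorm_le_bound _ (by positivity) fun y => ?_
  simp only [expoDeriv, smul_apply, ContinuousLinearMap.comp_apply, innerSL_apply_apply,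
    Complex.ofRealCLM_apply, smul_eq_mul, norm_mul, norm_expo, Complex.norm_real, Complex.norm_I,
    one_mul, mul_one, Complex.norm_ofNat, Real.norm_eq_abs, abs_of_pos Real.pi_pos]
  rw [mul_assoc (2 * Real.pi)]
  gcongr
  exact abs_real_inner_le_norm _ _

theorem expoDeriv_basisVec (n : Fin 2 → ℤ) (x : Plane) (i : Fin 2) :
    expoDeriv (freq n) x (basisVec i) = dsym i n * expo (freq n) x := by
  simp [expoDeriv, dsym, freq, EuclideanSpace.inner_single_right]
  ring

theorem norm_freq_le (n : Fin 2 → ℤ) : ‖freq n‖ ≤ 2 * ‖n‖ := by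
  have h (i : Fin 2) : |(n i : ℝ)| ≤ ‖n‖ := by
    simpa [Int.norm_eq_abs] using norm_le_pi_norm n i
  rw [EuclideanSpace.norm_eq, Real.sqrt_le_left (by positivity)]
  simp only [freq, Fin.sum_univ_two, Real.norm_eq_abs]
  nlinarith [h 0, h 1, abs_nonneg (n 0 : ℝ), abs_nonneg (n 1 : ℝ)]

theorem norm_smul_expoDeriv_le (a : (Fin 2 → ℤ) → ℂ) (n : Fin 2 → ℤ) (x : Plane) :
    ‖a n • expoDeriv (freq n) x‖ ≤ 4 * Real.pi * ((1 + ‖n‖) ^ 1 * ‖a n‖) := by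
  rw [norm_smul]
  calc ‖a n‖ * ‖expoDeriv (freq n) x‖ ≤ ‖a n‖ * (2 * Real.pi * (2 * (1 + ‖n‖))) := by
        gcongr
        refine (norm_expoDeriv_le _ _).trans ?_
        gcongr
        refine (norm_freq_le n).trans ?_
        linarith
    _ = _ := by ring

theorem sq_norm_le_freqSq (n : Fin 2 → ℤ) : ‖n‖ ^ 2 ≤ freqSq n := by
  have h : ‖n‖ ≤ Real.sqrt (freqSq n) := by
    refine (pi_norm_le_iff_of_nonneg (Real.sqrt_nonneg _)).2 fun i => ?_
    rw [Int.norm_eq_abs]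
    apply Real.abs_le_sqrt
    unfold freqSq
    fin_cases i <;> simp <;> positivity
  have h0 : 0 ≤ freqSq n := by unfold freqSq; positivity
  calc ‖n‖ ^ 2 ≤ Real.sqrt (freqSq n) ^ 2 := by gcongr
    _ = _ := Real.sq_sqrt h0

theorem one_le_norm {n : Fin 2 → ℤ} (hn : n ≠ 0) : 1 ≤ ‖n‖ := by
  obtain ⟨i, hi⟩ := Function.ne_iff.1 hn
  refine le_trans ?_ (norm_le_pi_norm n i)
  rw [Int.norm_eq_abs]
  exact_mod_cast Int.one_le_abs hi

theorem one_le_freqSq {n : Fin 2 → ℤ} (hn : n ≠ 0) : 1 ≤ freqSq n :=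
  (one_le_pow₀ (one_le_norm hn)).trans (sq_norm_le_freqSq n)

theorem norm_dsym_le (i : Fin 2) (n : Fin 2 → ℤ) : ‖dsym i n‖ ≤ 2 * Real.pi * (1 + ‖n‖) := by
  have h : |(n i : ℝ)| ≤ ‖n‖ := by simpa [Int.norm_eq_abs] using norm_le_pi_norm n i
  simp only [dsym, norm_mul, Complex.norm_ofNat, Complex.norm_real, Real.norm_eq_abs,
    abs_of_pos Real.pi_pos, Complex.norm_I, mul_one, Complex.norm_intCast]
  gcongr
  linarith

theorem sum_dsym_sq (n : Fin 2 → ℤ) :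
    ∑ i, dsym i n * dsym i n = ((-(4 * Real.pi ^ 2 * freqSq n) : ℝ) : ℂ) := by
  simp only [Fin.sum_univ_two, dsym, freqSq]
  push_cast
  linear_combination (4 * Real.pi ^ 2 * ((n 0 : ℂ) ^ 2 + (n 1 : ℂ) ^ 2)) * Complex.I_sq

namespace Rapid

variable {a : (Fin 2 → ℤ) → ℂ}

theorem mul (ha : Rapid a) {c : (Fin 2 → ℤ) → ℂ} {C : ℝ} {k : ℕ}
    (hc : ∀ n, ‖c n‖ ≤ C * (1 + ‖n‖) ^ k) : Rapid fun n => c n * a n := by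
  intro j
  refine ((ha (j + k)).mul_left C).of_nonneg_of_le (fun n => by positivity) fun n => ?_
  calc (1 + ‖n‖) ^ j * ‖c n * a n‖ = (1 + ‖n‖) ^ j * ‖c n‖ * ‖a n‖ := by rw [norm_mul]; ring
    _ ≤ (1 + ‖n‖) ^ j * (C * (1 + ‖n‖) ^ k) * ‖a n‖ := by gcongr; exact hc n
    _ = _ := by ring

theorem dsym_mul (ha : Rapid a) (i : Fin 2) : Rapid fun n => dsym i n * a n :=
  ha.mul (C := 2 * Real.pi) (k := 1) fun n => by simpa using norm_dsym_le i n

theorem summable_norm (ha : Rapid a) : Summable fun n => ‖a n‖ := by simpa using ha 0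

theorem summable_expo (ha : Rapid a) (x : Plane) : Summable fun n => a n * expo (freq n) x :=
  Summable.of_norm (by simpa using ha.summable_norm)

theorem hasFDerivAt_trig (ha : Rapid a) (x : Plane) :
    HasFDerivAt (trig a) (∑' n, a n • expoDeriv (freq n) x) x := by
  have hs : Summable fun n => 4 * Real.pi * ((1 + ‖n‖) ^ 1 * ‖a n‖) := (ha 1).mul_left _
  exact hasFDerivAt_tsum hs (fun n x => (hasFDerivAt_expo (freq n) x).const_smul (a n))
    (norm_smul_expoDeriv_le a) (ha.summable_expo 0) x

theorem pd_trig (ha : Rapid a) (i : Fin 2) : pd i (trig a) = trig fun n => dsym i n * a n := by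
  funext x
  have hs : Summable fun n => a n • expoDeriv (freq n) x :=
    Summable.of_norm_bounded ((ha 1).mul_left (4 * Real.pi)) fun n => norm_smul_expoDeriv_le a n x
  rw [pd, (ha.hasFDerivAt_trig x).fderiv, trig]
  have := (ContinuousLinearMap.apply ℝ ℂ (basisVec i)).map_tsum hs
  simp only [ContinuousLinearMap.apply_apply, smul_apply, expoDeriv_basisVec] at this
  rw [this]
  refine tsum_congr fun n => ?_
  rw [smul_eq_mul]; ring

theorem contDiff_trig (ha : Rapid a) : ContDiff ℝ ∞ (trig a) := by
  have key (k : ℕ) : ∀ a : (Fin 2 → ℤ) → ℂ, Rapid a → ContDiff ℝ k (trig a) := by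
    induction k with
    | zero =>
      intro a ha
      exact contDiff_zero.2 (continuous_iff_continuousAt.2 fun x =>
        (ha.hasFDerivAt_trig x).continuousAt)
    | succ k ih =>
      intro a ha
      rw [Nat.cast_succ, contDiff_succ_iff_fderiv_apply]
      refine ⟨fun x => (ha.hasFDerivAt_trig x).differentiableAt, by simp, fun y => ?_⟩
      have hy : y = ∑ i, y i • basisVec i := by
        ext j; fin_cases j <;> simp
      have e : (fun x => fderiv ℝ (trig a) x y) =
          fun x => ∑ i, y i • trig (fun n => dsym i n * a n) x := by
        funext x
        conv_lhs => rw [hy]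
        simp only [map_sum, map_smul]
        refine Finset.sum_congr rfl fun i _ => ?_
        rw [← ha.pd_trig i, pd]
      rw [e]
      exact ContDiff.sum fun i _ => (ih _ (ha.dsym_mul i)).const_smul (y i)
  exact contDiff_infty.2 fun k => key k a ha

end Rapid

theorem latticePeriodic_trig (a : (Fin 2 → ℤ) → ℂ) : LatticePeriodic (trig a) := by
  intro x i l
  simp only [trig, latticePeriodic_expo _ x i l]

/-! ### Fourier coefficients -/

/-- A continuous periodic function is bounded. -/
theorem LatticePeriodic.exists_bound {E : Type*} [NormedAddCommGroup E] {u : Plane → E}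
    (hu : LatticePeriodic u) (hc : Continuous u) : ∃ C, 0 ≤ C ∧ ∀ x, ‖u x‖ ≤ C := by
  obtain ⟨C, hC⟩ := isCompact_unitCell.exists_bound_of_continuousOn hc.continuousOn
  refine ⟨max C 0, le_max_right _ _, fun x => le_max_of_le_left ?_⟩
  rw [← hu.add_lattice x fun i => -⌊x i⌋]
  refine hC _ fun i => ?_
  simp only [PiLp.add_apply, Int.cast_neg]
  exact ⟨by linarith [Int.floor_le (x i)], by linarith [Int.lt_floor_add_one (x i)]⟩

/-- The integral of a derivative over a period vanishes: it is the derivative at `t = 0` of the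
integral of the translate by `t`, which does not depend on `t`. -/
theorem integral_pd_eq_zero {E : Type*} [NormedAddCommGroup E] [NormedSpace ℝ E] [CompleteSpace E]
    {v : Plane → E} (hp : LatticePeriodic v) (hv : ContDiff ℝ ∞ v) (i : Fin 2) :
    ∫ x in unitCell, pd i v x = 0 := by
  obtain ⟨C, -, hC⟩ := (hp.pd i).exists_bound (hv.pd i).continuous
  have : MeasureTheory.IsFiniteMeasure (MeasureTheory.volume.restrict unitCell) :=
    ⟨by simpa using isCompact_unitCell.measure_lt_top⟩
  have hd (t : ℝ) (x : Plane) :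
      HasDerivAt (fun t : ℝ => v (x + t • basisVec i)) (pd i v (x + t • basisVec i)) t := by
    have h1 : HasDerivAt (fun t : ℝ => x + t • basisVec i) (basisVec i) t := by
      simpa using ((hasDerivAt_id t).smul_const (basisVec i)).const_add x
    exact ((hv.differentiableAt_of_infty _).hasFDerivAt).comp_hasDerivAt t h1
  have hcont (t : ℝ) : Continuous fun x => v (x + t • basisVec i) :=
    hv.continuous.comp (by fun_prop)
  have hcont' (t : ℝ) : Continuous fun x => pd i v (x + t • basisVec i) :=
    (hv.pd i).continuous.comp (by fun_prop)
  have key := (hasDerivAt_integral_of_dominated_loc_of_deriv_le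
    (μ := MeasureTheory.volume.restrict unitCell) (F := fun (t : ℝ) x => v (x + t • basisVec i))
    (F' := fun (t : ℝ) x => pd i v (x + t • basisVec i)) (x₀ := 0) (bound := fun _ => C)
    Filter.univ_mem
    (Filter.Eventually.of_forall fun t => (hcont t).aestronglyMeasurable)
    ((hcont 0).continuousOn.integrableOn_compact isCompact_unitCell)
    (hcont' 0).aestronglyMeasurable
    (Filter.Eventually.of_forall fun x t _ => hC _)
    (MeasureTheory.integrable_const _)
    (Filter.Eventually.of_forall fun x t _ => hd t x)).2
  simp only [integral_unitCell_add hp, zero_smul, add_zero] at key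
  exact key.unique (hasDerivAt_const _ _)

theorem coef_pd {u : Plane → ℝ} (hp : LatticePeriodic u) (hu : ContDiff ℝ ∞ u) (i : Fin 2)
    (n : Fin 2 → ℤ) : coef (pd i u) n = dsym i n * coef u n := by
  have hu' : ContDiff ℝ ∞ fun x => (u x : ℂ) := Complex.ofRealCLM.contDiff.comp hu
  set v : Plane → ℂ := fun x => (u x : ℂ) * expo (-freq n) x with hv
  have hvs : ContDiff ℝ ∞ v := hu'.mul (contDiff_expo _)
  have hvp : LatticePeriodic v := fun x j l => by
    simp only [hv, neg_freq]
    rw [hp, latticePeriodic_expo]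
  have e : pd i v = fun x => ((pd i u x : ℝ) : ℂ) * expo (-freq n) x - dsym i n * v x := by
    funext x
    have h1 : HasFDerivAt (fun x => (u x : ℂ)) (Complex.ofRealCLM.comp (fderiv ℝ u x)) x :=
      Complex.ofRealCLM.hasFDerivAt.comp x (hu.differentiableAt_of_infty x).hasFDerivAt
    have h2 := h1.mul (hasFDerivAt_expo (-freq n) x)
    have h3 : pd i v x = _ := congrArg (fun L => L (basisVec i)) h2.fderiv
    rw [h3]
    simp only [add_apply, smul_apply, neg_freq, expoDeriv_basisVec, smul_eq_mul,
      ContinuousLinearMap.comp_apply, Complex.ofRealCLM_apply, hv]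
    have : dsym i (-n) = -dsym i n := by simp [dsym]
    rw [this, pd]
    ring
  have h0 := integral_pd_eq_zero hvp hvs i
  rw [e, MeasureTheory.integral_sub, MeasureTheory.integral_const_mul] at h0
  · exact sub_eq_zero.1 h0
  · refine ContinuousOn.integrableOn_compact isCompact_unitCell (Continuous.continuousOn ?_)
    exact (Complex.continuous_ofReal.comp (hu.pd i).continuous).mul (contDiff_expo _).continuous
  · refine ContinuousOn.integrableOn_compact isCompact_unitCell (Continuous.continuousOn ?_)
    exact continuous_const.mul hvs.continuous

theorem coef_add {u v : Plane → ℝ} (hu : Continuous u) (hv : Continuous v) (n : Fin 2 → ℤ) :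
    coef (u + v) n = coef u n + coef v n := by
  rw [coef, coef, coef, ← MeasureTheory.integral_add]
  · refine MeasureTheory.integral_congr_ae (Filter.Eventually.of_forall fun x => ?_)
    simp [add_mul]
  all_goals
    refine ContinuousOn.integrableOn_compact isCompact_unitCell (Continuous.continuousOn ?_)
    exact (Complex.continuous_ofReal.comp (by assumption)).mul (contDiff_expo _).continuous

theorem LatticePeriodic.lap {u : Plane → ℝ} (hp : LatticePeriodic u) (hu : ContDiff ℝ ∞ u) :
    LatticePeriodic (lap u) := by
  rw [lap_eq hu]
  intro x i l
  simp only [Finset.sum_apply]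
  exact Finset.sum_congr rfl fun j _ => (hp.pd j).pd j x i l

theorem coef_lap {u : Plane → ℝ} (hp : LatticePeriodic u) (hu : ContDiff ℝ ∞ u) (n : Fin 2 → ℤ) :
    coef (lap u) n = ((-(4 * Real.pi ^ 2 * freqSq n) : ℝ) : ℂ) * coef u n := by
  rw [lap_eq hu, ← sum_dsym_sq, Fin.sum_univ_two, Fin.sum_univ_two,
    coef_add ((hu.pd 0).pd 0).continuous ((hu.pd 1).pd 1).continuous]
  simp only [coef_pd (hp.pd _) (hu.pd _), coef_pd hp hu]
  ring

theorem exists_norm_coef_le (u : Plane → ℝ) : ∃ C, ∀ n, ‖coef u n‖ ≤ C :=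
  ⟨∫ y in unitCell, ‖u y‖, fun n => (MeasureTheory.norm_integral_le_integral_norm _).trans_eq
    (by simp)⟩

/-- Powers of the Laplacian preserve smoothness and periodicity and act diagonally on Fourier
coefficients. -/
theorem coef_lap_iterate {u : Plane → ℝ} (hp : LatticePeriodic u) (hu : ContDiff ℝ ∞ u) (k : ℕ) :
    LatticePeriodic (lap^[k] u) ∧ ContDiff ℝ ∞ (lap^[k] u) ∧
      ∀ n, coef (lap^[k] u) n = ((-(4 * Real.pi ^ 2 * freqSq n) : ℝ) : ℂ) ^ k * coef u n := by
  induction k with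
  | zero => exact ⟨hp, hu, fun n => by simp⟩
  | succ k ih =>
    obtain ⟨h1, h2, h3⟩ := ih
    rw [Function.iterate_succ_apply']
    exact ⟨h1.lap h2, h2.lap, fun n => by rw [coef_lap h1 h2, h3, pow_succ]; ring⟩

/-- The coefficients of a smooth function decay rapidly, because those of its iterated Laplacians
are bounded. -/
theorem rapid_coef {u : Plane → ℝ} (hp : LatticePeriodic u) (hu : ContDiff ℝ ∞ u) :
    Rapid (coef u) := by
  intro j
  -- three more powers of the frequency make the sum over `ℤ²` converge
  obtain ⟨-, -, h⟩ := coef_lap_iterate hp hu (j + 3)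
  obtain ⟨C, hC⟩ := exists_norm_coef_le (lap^[j + 3] u)
  have hsum := EisensteinSeries.summable_one_div_norm_rpow (k := 3) (by norm_num)
  refine Summable.of_norm_bounded_eventually (hsum.mul_left (2 ^ j * C)) ?_
  have hfin : ∀ᶠ n : Fin 2 → ℤ in Filter.cofinite, n ≠ 0 := by
    simp [Filter.eventually_cofinite]
  filter_upwards [hfin] with n hn
  have h1 := one_le_norm hn
  have h2 := sq_norm_le_freqSq n
  have h3 : ‖n‖ ^ (j + 3) * ‖coef u n‖ ≤ C := by
    refine le_trans ?_ (hC n)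
    rw [h n, norm_mul, norm_pow, Complex.norm_real, norm_neg, Real.norm_eq_abs]
    gcongr
    refine le_trans ?_ (le_abs_self _)
    have hpi : 1 ≤ 4 * Real.pi ^ 2 := by nlinarith [Real.pi_gt_three]
    nlinarith
  rw [Real.rpow_neg (by positivity), norm_mul, norm_pow, norm_norm,
    Real.norm_of_nonneg (by positivity)]
  have h5 : ‖n‖ ^ (3 : ℝ) = ‖n‖ ^ 3 := by norm_cast
  rw [h5]
  have h4 : 0 < ‖n‖ ^ 3 := by positivity
  rw [← div_eq_mul_inv, le_div_iff₀ h4]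
  calc (1 + ‖n‖) ^ j * ‖coef u n‖ * ‖n‖ ^ 3 ≤ (2 * ‖n‖) ^ j * ‖coef u n‖ * ‖n‖ ^ 3 := by
        gcongr; linarith
    _ = 2 ^ j * (‖n‖ ^ (j + 3) * ‖coef u n‖) := by ring
    _ ≤ _ := by gcongr

theorem mFourier_coe (n : Fin 2 → ℤ) (x : Fin 2 → ℝ) :
    UnitAddTorus.mFourier n (fun i => (x i : UnitAddCircle)) = expo (freq n) (WithLp.toLp 2 x) := by
  simp only [UnitAddTorus.mFourier, ContinuousMap.coe_mk, Fin.prod_univ_two, fourier_coe_apply,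
    ← Complex.exp_add, expo]
  congr 1
  simp [freq, PiLp.inner_apply]
  ring

/-- Fourier inversion for smooth periodic functions. -/
theorem ofReal_eq_trig_coef {u : Plane → ℝ} (hp : LatticePeriodic u) (hu : ContDiff ℝ ∞ u)
    (x : Plane) : (u x : ℂ) = trig (coef u) x := by
  have hp' : LatticePeriodic fun x => (u x : ℂ) := fun x i l => by simp only [hp x i l]
  have hq : IsOpenQuotientMap (fun (x : Fin 2 → ℝ) (i : Fin 2) => (x i : UnitAddCircle)) :=
    IsOpenQuotientMap.piMap fun _ => QuotientAddGroup.isOpenQuotientMap_mk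
  have hcont : Continuous (toTorus fun x => (u x : ℂ)) := by
    rw [hq.isQuotientMap.continuous_iff]
    have : (toTorus fun x => (u x : ℂ)) ∘ (fun (x : Fin 2 → ℝ) i => (x i : UnitAddCircle)) =
        fun x => (u (WithLp.toLp 2 x) : ℂ) := funext fun x => toTorus_coe hp' x
    rw [this]
    exact Complex.continuous_ofReal.comp (hu.continuous.comp (by fun_prop))
  let f : C(UnitAddTorus (Fin 2), ℂ) := ⟨_, hcont⟩
  have hcoef : UnitAddTorus.mFourierCoeff f = coef u := by
    funext n
    rw [UnitAddTorus.mFourierCoeff_eq_integral f n 0, coef,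
      MeasureTheory.setIntegral_congr_set unitCell_ae_eq_latticeBox]
    have e := (PiLp.volume_preserving_toLp (Fin 2)).setIntegral_preimage_emb
      (MeasurableEquiv.toLp 2 (Fin 2 → ℝ)).measurableEmbedding
      (fun y => (u y : ℂ) * expo (-freq n) y) (latticeBox 0 1)
    rw [← e]
    have hset : {x : Fin 2 → ℝ | ∀ i, x i ∈ Set.Ioc ((0 : Fin 2 → ℝ) i) ((0 : Fin 2 → ℝ) i + 1)} =
        WithLp.toLp 2 ⁻¹' latticeBox 0 1 := by
      ext x; simp [latticeBox]
    rw [hset]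
    congr 1
    funext y
    simp only [f, ContinuousMap.coe_mk, mFourier_coe, toTorus_coe hp', smul_eq_mul, neg_freq]
    ring
  have hsum : Summable (UnitAddTorus.mFourierCoeff f) := by
    rw [hcoef]
    exact (rapid_coef hp hu).summable_norm.of_norm
  have := UnitAddTorus.hasSum_mFourier_series_apply_of_summable hsum fun i => (x i : UnitAddCircle)
  rw [hcoef] at this
  simp only [mFourier_coe, smul_eq_mul] at this
  rw [trig, this.tsum_eq]
  exact (toTorus_coe hp' _).symm

/-! ### The inverse Laplacian on the torus -/

/-- The symbol of `Δ^{-k}` on functions of mean zero. -/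
noncomputable def invSym (k : ℕ) (n : Fin 2 → ℤ) : ℂ :=
  if n = 0 then 0 else (((-(4 * Real.pi ^ 2 * freqSq n)) ^ k)⁻¹ : ℝ)

theorem norm_invSym_le (k : ℕ) (n : Fin 2 → ℤ) : ‖invSym k n‖ ≤ 1 := by
  unfold invSym
  split_ifs with h
  · simp
  · rw [Complex.norm_real, norm_inv, norm_pow, norm_neg, Real.norm_eq_abs]
    refine inv_le_one_of_one_le₀ (one_le_pow₀ ?_)
    refine le_trans ?_ (le_abs_self _)
    have h1 := one_le_freqSq h
    have hpi : 1 ≤ 4 * Real.pi ^ 2 := by nlinarith [Real.pi_gt_three]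
    nlinarith

theorem sym_mul_invSym_succ (k : ℕ) (n : Fin 2 → ℤ) :
    ((-(4 * Real.pi ^ 2 * freqSq n) : ℝ) : ℂ) * invSym (k + 1) n = invSym k n := by
  unfold invSym
  split_ifs with h
  · simp
  · have h1 := one_le_freqSq h
    have h2 : -(4 * Real.pi ^ 2 * freqSq n) ≠ 0 := by
      have := Real.pi_pos
      have : 0 < 4 * Real.pi ^ 2 * freqSq n := by positivity
      linarith
    rw [← Complex.ofReal_mul]
    congr 1
    rw [pow_succ _ k, mul_inv, mul_comm, mul_assoc, inv_mul_cancel₀ h2, mul_one]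

theorem Rapid.invSym_mul {a : (Fin 2 → ℤ) → ℂ} (ha : Rapid a) (k : ℕ) :
    Rapid fun n => invSym k n * a n :=
  ha.mul (C := 1) (k := 0) fun n => by simpa using norm_invSym_le k n

theorem pd_re {v : Plane → ℂ} (hv : ContDiff ℝ ∞ v) (i : Fin 2) :
    pd i (fun x => (v x).re) = fun x => (pd i v x).re := by
  funext x
  have := (Complex.reCLM.hasFDerivAt.comp x (hv.differentiableAt_of_infty x).hasFDerivAt).fderiv
  exact congrArg (fun L => L (basisVec i)) this

theorem contDiff_re {v : Plane → ℂ} (hv : ContDiff ℝ ∞ v) : ContDiff ℝ ∞ fun x => (v x).re :=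
  Complex.reCLM.contDiff.comp hv

theorem pd_re_trig {a : (Fin 2 → ℤ) → ℂ} (ha : Rapid a) (i : Fin 2) :
    pd i (fun x => (trig a x).re) = fun x => (trig (fun n => dsym i n * a n) x).re := by
  rw [pd_re ha.contDiff_trig, ha.pd_trig]

theorem trig_add {a b : (Fin 2 → ℤ) → ℂ} (ha : Rapid a) (hb : Rapid b) (x : Plane) :
    trig (fun n => a n + b n) x = trig a x + trig b x := by
  simp only [trig, add_mul]
  exact (ha.summable_expo x).tsum_add (hb.summable_expo x)

theorem lap_re_trig {a : (Fin 2 → ℤ) → ℂ} (ha : Rapid a) :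
    lap (fun x => (trig a x).re) =
      fun x => (trig (fun n => ((-(4 * Real.pi ^ 2 * freqSq n) : ℝ) : ℂ) * a n) x).re := by
  rw [lap_eq (contDiff_re ha.contDiff_trig)]
  funext x
  simp only [Fin.sum_univ_two, Pi.add_apply, pd_re_trig ha, pd_re_trig (ha.dsym_mul _)]
  rw [← Complex.add_re, ← trig_add ((ha.dsym_mul 0).dsym_mul 0) ((ha.dsym_mul 1).dsym_mul 1)]
  congr 2
  funext n
  rw [← sum_dsym_sq, Fin.sum_univ_two]
  ring

/-- The function `Δ^{-k} g` as a Fourier series. -/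
theorem invLap_eq_re_trig {g : Plane → ℝ} (hp : LatticePeriodic g) (hg : ContDiff ℝ ∞ g) (k : ℕ) :
    invLap k g = fun x => (trig (fun n => invSym k n * coef g n) x).re := by
  funext x
  have hr := (rapid_coef hp hg).invSym_mul k
  rw [trig, Complex.re_tsum (hr.summable_expo x), invLap, ← (finTwoArrowEquiv ℤ).tsum_eq]
  refine tsum_congr fun n => ?_
  have hn : finTwoArrowEquiv ℤ n = 0 ↔ n = 0 := by
    simp [Prod.ext_iff, funext_iff, Fin.forall_fin_two]
  simp only [hn, invSym]
  split_ifs with h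
  · simp
  · have hi : MeasureTheory.Integrable (fun y => (g y : ℂ) * expo (-freq n) y * expo (freq n) x)
        (MeasureTheory.volume.restrict unitCell) := by
      refine ContinuousOn.integrableOn_compact isCompact_unitCell (Continuous.continuousOn ?_)
      exact ((Complex.continuous_ofReal.comp hg.continuous).mul (contDiff_expo _).continuous).mul
        continuous_const
    rw [mul_assoc _ (coef g n), Complex.re_ofReal_mul, coef, ← MeasureTheory.integral_mul_const]
    have h3 := Complex.reCLM.integral_comp_comm hi
    simp only [Complex.reCLM_apply] at h3
    rw [← h3]
    simp only [finTwoArrowEquiv_apply, freqSq]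
    congr 1
    refine MeasureTheory.integral_congr_ae (Filter.Eventually.of_forall fun y => ?_)
    simp only
    rw [mul_assoc (g y : ℂ), Complex.re_ofReal_mul, expo_neg_left, ← expo_add, expo,
      Complex.exp_ofReal_mul_I_re]
    congr 3
    simp [freq, PiLp.inner_apply, Fin.sum_univ_two]
    ring

theorem contDiff_coe (g : PeriodicMeanZero) : ContDiff ℝ ∞ (g : Plane → ℝ) := g.2.1

theorem periodic_coe (g : PeriodicMeanZero) : LatticePeriodic (g : Plane → ℝ) := g.2.2.1

theorem coef_zero_coe (g : PeriodicMeanZero) : coef g 0 = 0 := by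
  have h : freq 0 = 0 := by ext i; simp [freq]
  simp only [coef, h, expo, neg_zero, inner_zero_left, mul_zero, Complex.ofReal_zero, zero_mul,
    Complex.exp_zero, mul_one]
  rw [integral_complex_ofReal, g.2.2.2, Complex.ofReal_zero]

/-- Partial derivatives on periodic functions of mean zero. -/
noncomputable def pdP (i : Fin 2) : PeriodicMeanZero →ₗ[ℝ] PeriodicMeanZero where
  toFun g := ⟨pd i g, (contDiff_coe g).pd i, (periodic_coe g).pd i,
    integral_pd_eq_zero (periodic_coe g) (contDiff_coe g) i⟩
  map_add' f g := Subtype.ext (pd_add (contDiff_coe f) (contDiff_coe g) i)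
  map_smul' c g := Subtype.ext (pd_const_smul (contDiff_coe g) c i)

/-- The Laplacian on periodic functions of mean zero. -/
noncomputable def lapP : PeriodicMeanZero →ₗ[ℝ] PeriodicMeanZero := ∑ i, pdP i ∘ₗ pdP i

@[simp] theorem coe_pdP (i : Fin 2) (g : PeriodicMeanZero) :
    (pdP i g : Plane → ℝ) = pd i g := rfl

theorem coe_lapP (g : PeriodicMeanZero) : (lapP g : Plane → ℝ) = lap g := by
  rw [lap_eq (contDiff_coe g)]
  simp [lapP]

theorem coef_lapP (g : PeriodicMeanZero) (n : Fin 2 → ℤ) :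
    coef (lapP g) n = ((-(4 * Real.pi ^ 2 * freqSq n) : ℝ) : ℂ) * coef g n := by
  rw [coe_lapP, coef_lap (periodic_coe g) (contDiff_coe g)]

theorem lapP_injective : Function.Injective lapP := by
  rw [← LinearMap.ker_eq_bot, LinearMap.ker_eq_bot']
  intro g hg
  have h0 : coef g = 0 := by
    funext n
    by_cases hn : n = 0
    · rw [hn, coef_zero_coe g]; rfl
    · have h1 := coef_lapP g n
      rw [hg] at h1
      have h2 : coef ((0 : PeriodicMeanZero) : Plane → ℝ) n = 0 := by simp [coef]
      rw [h2] at h1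
      have h3 := one_le_freqSq hn
      have h4 : ((-(4 * Real.pi ^ 2 * freqSq n) : ℝ) : ℂ) ≠ 0 := by
        have := Real.pi_pos
        have : 0 < 4 * Real.pi ^ 2 * freqSq n := by positivity
        exact_mod_cast (by linarith : -(4 * Real.pi ^ 2 * freqSq n) ≠ 0)
      exact (mul_eq_zero.1 h1.symm).resolve_left h4
  ext x
  have := ofReal_eq_trig_coef (periodic_coe g) (contDiff_coe g) x
  rw [h0] at this
  simpa [trig] using this

theorem invLap_zero (g : PeriodicMeanZero) : invLap 0 g = g := by
  rw [invLap_eq_re_trig (periodic_coe g) (contDiff_coe g)]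
  funext x
  rw [← Complex.ofReal_re ((g : Plane → ℝ) x),
    ofReal_eq_trig_coef (periodic_coe g) (contDiff_coe g)]
  congr 2
  funext n
  by_cases hn : n = 0
  · simp [hn, invSym, coef_zero_coe g]
  · simp [hn, invSym]

theorem lap_invLap_succ (g : PeriodicMeanZero) (k : ℕ) : lap (invLap (k + 1) g) = invLap k g := by
  rw [invLap_eq_re_trig (periodic_coe g) (contDiff_coe g),
    invLap_eq_re_trig (periodic_coe g) (contDiff_coe g),
    lap_re_trig ((rapid_coef (periodic_coe g) (contDiff_coe g)).invSym_mul _)]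
  simp only [← mul_assoc, sym_mul_invSym_succ]

theorem contDiff_invLap (g : PeriodicMeanZero) (k : ℕ) : ContDiff ℝ ∞ (invLap k g) := by
  rw [invLap_eq_re_trig (periodic_coe g) (contDiff_coe g)]
  exact contDiff_re ((rapid_coef (periodic_coe g) (contDiff_coe g)).invSym_mul _).contDiff_trig

theorem latticePeriodic_invLap (g : PeriodicMeanZero) (k : ℕ) : LatticePeriodic (invLap k g) := by
  rw [invLap_eq_re_trig (periodic_coe g) (contDiff_coe g)]
  intro x i l
  simp only [latticePeriodic_trig _ x i l]

theorem invLap_mem (g : PeriodicMeanZero) (k : ℕ) : invLap k g ∈ PeriodicMeanZero := by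
  refine ⟨contDiff_invLap g k, latticePeriodic_invLap g k, ?_⟩
  -- the mean vanishes because the function is a Laplacian
  have hs := contDiff_invLap g (k + 1)
  have hp := latticePeriodic_invLap g (k + 1)
  rw [← lap_invLap_succ, lap_eq hs]
  simp only [Finset.sum_apply]
  rw [MeasureTheory.integral_finsetSum]
  · exact Finset.sum_eq_zero fun i _ => integral_pd_eq_zero (hp.pd i) (hs.pd i) i
  · exact fun i _ => ((hs.pd i).pd i).continuous.continuousOn.integrableOn_compact
      isCompact_unitCell

theorem lapP_surjective : Function.Surjective lapP := fun g =>
  ⟨⟨invLap 1 g, invLap_mem g 1⟩, Subtype.ext <| by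
    rw [coe_lapP]
    exact (lap_invLap_succ g 0).trans (invLap_zero g)⟩

/-- The Laplacian as an automorphism of the space of periodic functions of mean zero. -/
noncomputable def lapEquiv : PeriodicMeanZero ≃ₗ[ℝ] PeriodicMeanZero :=
  LinearEquiv.ofBijective lapP ⟨lapP_injective, lapP_surjective⟩

/-- The powers `Δ^{-k}` of the inverse Laplacian on periodic functions of mean zero. -/
noncomputable def invPow (k : ℕ) : PeriodicMeanZero →ₗ[ℝ] PeriodicMeanZero :=
  (lapEquiv.symm : PeriodicMeanZero →ₗ[ℝ] PeriodicMeanZero) ^ k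

@[simp] theorem invPow_zero (g : PeriodicMeanZero) : invPow 0 g = g := rfl

theorem invPow_add (j k : ℕ) (g : PeriodicMeanZero) : invPow (j + k) g = invPow j (invPow k g) := by
  simp [invPow, pow_add]

theorem lapP_invPow_succ (k : ℕ) (g : PeriodicMeanZero) : lapP (invPow (k + 1) g) = invPow k g := by
  have h : invPow (k + 1) g = lapEquiv.symm (invPow k g) := by simp [invPow, pow_succ']
  rw [h]
  exact lapEquiv.apply_symm_apply _

theorem coe_invPow (k : ℕ) (g : PeriodicMeanZero) : (invPow k g : Plane → ℝ) = invLap k g := by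
  induction k with
  | zero => exact (invLap_zero g).symm
  | succ k ih =>
    have h : invPow (k + 1) g = ⟨invLap (k + 1) g, invLap_mem g (k + 1)⟩ := by
      apply lapP_injective
      rw [lapP_invPow_succ]
      apply Subtype.ext
      rw [ih, coe_lapP]
      exact (lap_invLap_succ g k).symm
    rw [h]

theorem pdP_comm (i j : Fin 2) (g : PeriodicMeanZero) : pdP i (pdP j g) = pdP j (pdP i g) :=
  Subtype.ext (pd_comm (contDiff_coe g) i j)

theorem pdP_lapP (i : Fin 2) (g : PeriodicMeanZero) : pdP i (lapP g) = lapP (pdP i g) := by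
  simp only [lapP, Fin.sum_univ_two, LinearMap.add_apply, LinearMap.comp_apply, map_add]
  rw [pdP_comm i 0, pdP_comm i 0, pdP_comm i 1, pdP_comm i 1]

theorem pdP_invPow (i : Fin 2) (k : ℕ) (g : PeriodicMeanZero) :
    pdP i (invPow k g) = invPow k (pdP i g) := by
  induction k with
  | zero => rfl
  | succ k ih =>
    apply lapP_injective
    rw [← pdP_lapP, lapP_invPow_succ, lapP_invPow_succ, ih]

/-- Iterated partial derivatives on periodic functions of mean zero. -/
noncomputable def pdsP : List (Fin 2) → PeriodicMeanZero →ₗ[ℝ] PeriodicMeanZero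
  | [] => LinearMap.id
  | i :: w => pdP i ∘ₗ pdsP w

@[simp] theorem pdsP_nil (g : PeriodicMeanZero) : pdsP [] g = g := rfl

@[simp] theorem pdsP_cons (i : Fin 2) (w : List (Fin 2)) (g : PeriodicMeanZero) :
    pdsP (i :: w) g = pdP i (pdsP w g) := rfl

theorem coe_pdsP (w : List (Fin 2)) (g : PeriodicMeanZero) : (pdsP w g : Plane → ℝ) = pds w g := by
  induction w with
  | nil => rfl
  | cons i w ih => rw [pdsP_cons, coe_pdP, ih, pds_cons]

theorem pdP_pdsP (i : Fin 2) (w : List (Fin 2)) (g : PeriodicMeanZero) :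
    pdP i (pdsP w g) = pdsP w (pdP i g) := by
  induction w with
  | nil => rfl
  | cons j w ih => rw [pdsP_cons, pdsP_cons, pdP_comm, ih]

/-! ### Dilations -/

theorem pd_dilate (lam : ℕ) {u : Plane → ℝ} (hu : ContDiff ℝ ∞ u) (i : Fin 2) :
    pd i (dilate lam u) = (lam : ℝ) • dilate lam (pd i u) := by
  funext x
  have h1 : HasFDerivAt (fun x : Plane => (lam : ℝ) • x)
      ((lam : ℝ) • ContinuousLinearMap.id ℝ Plane) x :=
    (hasFDerivAt_id x).const_smul (lam : ℝ)
  have h2 := ((hu.differentiableAt_of_infty ((lam : ℝ) • x)).hasFDerivAt.comp x h1).fderiv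
  change fderiv ℝ (u ∘ fun x => (lam : ℝ) • x) x (basisVec i) =
    (lam : ℝ) * fderiv ℝ u ((lam : ℝ) • x) (basisVec i)
  rw [h2]
  simp

theorem pdP_osc (lam : ℕ) (hl : 1 ≤ lam) (i : Fin 2) (g : PeriodicMeanZero) :
    pdP i (osc lam hl g) = (lam : ℝ) • osc lam hl (pdP i g) :=
  Subtype.ext (pd_dilate lam (contDiff_coe g) i)

theorem osc_add (lam : ℕ) (hl : 1 ≤ lam) (f g : PeriodicMeanZero) :
    osc lam hl (f + g) = osc lam hl f + osc lam hl g := rfl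

theorem osc_smul (lam : ℕ) (hl : 1 ≤ lam) (c : ℝ) (g : PeriodicMeanZero) :
    osc lam hl (c • g) = c • osc lam hl g := rfl

theorem lapP_osc (lam : ℕ) (hl : 1 ≤ lam) (g : PeriodicMeanZero) :
    lapP (osc lam hl g) = (lam : ℝ) ^ 2 • osc lam hl (lapP g) := by
  simp only [lapP, Fin.sum_univ_two, LinearMap.add_apply, LinearMap.comp_apply, pdP_osc, map_smul,
    osc_add, smul_add, smul_smul, sq]

/-- Oscillation at frequency `λ` makes `Δ^{-k}` smaller by the factor `λ^{-2k}`. -/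
theorem invPow_osc (lam : ℕ) (hl : 1 ≤ lam) (k : ℕ) (g : PeriodicMeanZero) :
    invPow k (osc lam hl g) = ((lam : ℝ) ^ (2 * k))⁻¹ • osc lam hl (invPow k g) := by
  have h0 : (lam : ℝ) ≠ 0 := by positivity
  induction k with
  | zero => simp
  | succ k ih =>
    apply lapP_injective
    rw [lapP_invPow_succ, ih, map_smul, lapP_osc, lapP_invPow_succ, smul_smul]
    congr 1
    field_simp
    ring

/-! ### Operators of negative order as averages of translates -/

section kernel

open scoped FourierTransform SchwartzMap
open MeasureTheory

/-- The symbol of the iterated partial derivative `∂^w`. -/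
noncomputable def wordSym (w : List (Fin 2)) (n : Fin 2 → ℤ) : ℂ := (w.map fun i => dsym i n).prod

@[simp] theorem wordSym_cons (i : Fin 2) (w : List (Fin 2)) (n : Fin 2 → ℤ) :
    wordSym (i :: w) n = dsym i n * wordSym w n := by simp [wordSym]

theorem pds_re_trig (w : List (Fin 2)) {a : (Fin 2 → ℤ) → ℂ} (ha : Rapid a) :
    Rapid (fun n => wordSym w n * a n) ∧
      pds w (fun x => (trig a x).re) = fun x => (trig (fun n => wordSym w n * a n) x).re := by
  induction w with
  | nil => simpa [wordSym] using ha
  | cons i w ih =>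
    obtain ⟨h1, h2⟩ := ih
    simp only [wordSym_cons, mul_assoc]
    exact ⟨h1.dsym_mul i, by rw [pds_cons, h2, pd_re_trig h1]⟩

/-- A fixed smooth bump on the half-line, supported in `[1/4, 3/4]`. -/
noncomputable def cutoff : ContDiffBump (1 / 2 : ℝ) := ⟨1 / 8, 1 / 4, by norm_num, by norm_num⟩

theorem cutoff_eq_zero {t : ℝ} (ht : 3 / 4 ≤ t) : cutoff t = 0 := by
  refine cutoff.zero_of_le_dist ?_
  have : cutoff.rOut = 1 / 4 := rfl
  rw [this, Real.dist_eq, abs_of_nonneg] <;> linarith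

/-- The multiplier `∏ⱼ (2πi ξ_{wⱼ}) χ(|ξ|²)`, a compactly supported version of the symbol of
`∂^w`. -/
noncomputable def cutSym (w : List (Fin 2)) (ξ : Plane) : ℂ :=
  (w.map fun i => 2 * Real.pi * Complex.I * (ξ i : ℂ)).prod * (cutoff (‖ξ‖ ^ 2) : ℝ)

theorem contDiff_cutSym (w : List (Fin 2)) : ContDiff ℝ ∞ (cutSym w) := by
  have h1 : ContDiff ℝ ∞ fun ξ : Plane => ((cutoff (‖ξ‖ ^ 2) : ℝ) : ℂ) :=
    Complex.ofRealCLM.contDiff.comp (cutoff.contDiff.comp (contDiff_norm_sq ℝ))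
  refine ContDiff.mul ?_ h1
  induction w with
  | nil => simpa using contDiff_const
  | cons i w ih =>
    simp only [List.map_cons, List.prod_cons]
    refine ContDiff.mul (contDiff_const.mul ?_) ih
    exact Complex.ofRealCLM.contDiff.comp (EuclideanSpace.proj (𝕜 := ℝ) i).contDiff

theorem hasCompactSupport_cutSym (w : List (Fin 2)) : HasCompactSupport (cutSym w) := by
  refine HasCompactSupport.of_support_subset_isCompact (isCompact_closedBall (0 : Plane) 1)
    fun ξ hξ => ?_
  by_contra h
  have h1 : 1 < ‖ξ‖ := by simpa using h
  refine hξ ?_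
  have : cutoff (‖ξ‖ ^ 2) = 0 := cutoff_eq_zero (by nlinarith)
  simp [cutSym, this]

theorem cutSym_smul_freq (w : List (Fin 2)) (r : ℝ) (n : Fin 2 → ℤ) :
    cutSym w (r • freq n) =
      (r : ℂ) ^ w.length * wordSym w n * (cutoff (r ^ 2 * freqSq n) : ℝ) := by
  have h1 : ‖r • freq n‖ ^ 2 = r ^ 2 * freqSq n := by
    rw [norm_smul, mul_pow, Real.norm_eq_abs, sq_abs, EuclideanSpace.norm_sq_eq]
    simp [freq, freqSq, Fin.sum_univ_two]
  rw [cutSym, h1]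
  congr 1
  clear h1
  induction w with
  | nil => simp [wordSym]
  | cons i w ih =>
    rw [List.map_cons, List.prod_cons, ih, wordSym_cons, List.length_cons, pow_succ]
    simp [freq, dsym]
    ring

/-- The Schwartz function with Fourier transform `cutSym w`. -/
noncomputable def kern (w : List (Fin 2)) : 𝓢(Plane, ℂ) :=
  𝓕⁻ ((hasCompactSupport_cutSym w).toSchwartzMap (contDiff_cutSym w))

theorem integral_kern_mul_expo (w : List (Fin 2)) (n : Fin 2 → ℤ) (r : ℝ) (x : Plane) :
    ∫ z, kern w z * expo (freq n) (x - r • z) = expo (freq n) x * cutSym w (r • freq n) := by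
  have h1 : 𝓕 (kern w) = (hasCompactSupport_cutSym w).toSchwartzMap (contDiff_cutSym w) :=
    FourierTransform.fourier_fourierInv_eq _
  have h2 : 𝓕 (kern w : Plane → ℂ) (r • freq n) = cutSym w (r • freq n) := by
    rw [← SchwartzMap.fourier_coe, h1]; rfl
  rw [← h2, Real.fourier_eq, ← integral_const_mul]
  refine integral_congr_ae (Filter.Eventually.of_forall fun z => ?_)
  simp only
  have h3 : expo (freq n) (-(r • z)) = (Real.fourierChar (-inner ℝ z (r • freq n)) : ℂ) := by
    rw [expo, Real.fourierChar_apply, inner_neg_right, inner_smul_right, inner_smul_right,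
      real_inner_comm]
  rw [sub_eq_add_neg, expo_add, h3, Circle.smul_def, smul_eq_mul]
  ring

/-- The normalizing constant `∫₀¹ s^{2L-1} χ(s²) ds`. -/
noncomputable def cutMass (L : ℕ) : ℝ := ∫ s in (0 : ℝ)..1, s ^ (2 * L - 1) * cutoff (s ^ 2)

theorem continuous_cutoff_sq (L : ℕ) (q : ℝ) :
    Continuous fun s : ℝ => s ^ L * cutoff (s ^ 2 * q) :=
  (continuous_pow L).mul (cutoff.continuous.comp (by fun_prop))

theorem cutMass_pos (L : ℕ) : 0 < cutMass L := by
  have hc : Continuous fun s : ℝ => s ^ (2 * L - 1) * cutoff (s ^ 2) := by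
    simpa using continuous_cutoff_sq (2 * L - 1) 1
  refine intervalIntegral.integral_pos zero_lt_one hc.continuousOn
    (fun s hs => mul_nonneg (pow_nonneg hs.1.le _) cutoff.nonneg) ⟨7 / 10, by norm_num, ?_⟩
  refine mul_pos (by positivity) (cutoff.pos_of_mem_ball ?_)
  have : cutoff.rOut = 1 / 4 := rfl
  rw [this, Metric.mem_ball, Real.dist_eq, abs_lt]
  norm_num

/-- Since the cutoff vanishes beyond `1` and every nonzero frequency has length at least `1`, the
scales `r ∈ (0, 1]` reproduce the exact power `|n|^{-2L}`. -/
theorem integral_cutoff_scale {L : ℕ} (hL : 1 ≤ L) {q : ℝ} (hq : 1 ≤ q) :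
    ∫ r in (0 : ℝ)..1, r ^ (2 * L - 1) * cutoff (r ^ 2 * q) = (q ^ L)⁻¹ * cutMass L := by
  set σ := Real.sqrt q
  have hσ1 : 1 ≤ σ := Real.one_le_sqrt.2 hq
  have hσ0 : σ ≠ 0 := by positivity
  have hσq : σ ^ 2 = q := Real.sq_sqrt (by linarith)
  set F : ℝ → ℝ := fun s => s ^ (2 * L - 1) * cutoff (s ^ 2)
  have hF : Continuous F := by simpa using continuous_cutoff_sq (2 * L - 1) 1
  have h1 : ∀ r : ℝ, r ^ (2 * L - 1) * cutoff (r ^ 2 * q) =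
      (σ ^ (2 * L - 1))⁻¹ * F (σ * r) := by
    intro r
    simp only [F, mul_pow, hσq]
    rw [mul_comm (r ^ 2) q]
    field_simp
  have h2 : ∫ s in (1 : ℝ)..σ, F s = 0 := by
    rw [← intervalIntegral.integral_zero (a := (1 : ℝ)) (b := σ)]
    refine intervalIntegral.integral_congr fun s hs => ?_
    rw [Set.uIcc_of_le hσ1] at hs
    have : cutoff (s ^ 2) = 0 := cutoff_eq_zero (by nlinarith [hs.1])
    simp [F, this]
  have h3 : ∫ s in (0 : ℝ)..σ, F s = cutMass L := by
    rw [← intervalIntegral.integral_add_adjacent_intervals (b := 1)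
      (hF.intervalIntegrable _ _) (hF.intervalIntegrable _ _), h2, add_zero]
    rfl
  simp_rw [h1]
  rw [intervalIntegral.integral_const_mul, intervalIntegral.integral_comp_mul_left F hσ0, mul_zero,
    mul_one, h3, smul_eq_mul, ← mul_assoc, ← mul_inv, ← pow_succ, ← hσq, ← pow_mul]
  congr 4
  omega

/-- The measure on scales `r ∈ (0, 1]` and shifts `z ∈ ℝ²` over which translates are averaged. -/
noncomputable def scaleMeasure : Measure (ℝ × Plane) :=
  (volume.restrict (Set.Ioc (0 : ℝ) 1)).prod volume

instance : SFinite scaleMeasure := by unfold scaleMeasure; infer_instance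

/-- The complex averaging kernel representing `∂^w Δ^{-L}`. -/
noncomputable def avgKernel (w : List (Fin 2)) (L : ℕ) (p : ℝ × Plane) : ℂ :=
  ((((-(4 * Real.pi ^ 2)) ^ L)⁻¹ * (cutMass L)⁻¹ * p.1 ^ (2 * L - 1 - w.length) : ℝ) : ℂ) *
    kern w p.2

theorem continuous_avgKernel (w : List (Fin 2)) (L : ℕ) : Continuous (avgKernel w L) := by
  unfold avgKernel
  refine Continuous.mul (Complex.continuous_ofReal.comp (by fun_prop)) ?_
  exact (kern w).continuous.comp continuous_snd

theorem integrable_avgKernel (w : List (Fin 2)) (L : ℕ) :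
    Integrable (avgKernel w L) scaleMeasure := by
  refine Integrable.mul_prod (f := fun r : ℝ => ((((-(4 * Real.pi ^ 2)) ^ L)⁻¹ * (cutMass L)⁻¹ *
    r ^ (2 * L - 1 - w.length) : ℝ) : ℂ)) ?_ (kern w).integrable
  refine (Continuous.integrableOn_Ioc ?_)
  exact Complex.continuous_ofReal.comp (by fun_prop)

theorem integrable_avgKernel_mul (w : List (Fin 2)) (L : ℕ) (n : Fin 2 → ℤ) (x : Plane) :
    Integrable (fun p => avgKernel w L p * expo (freq n) (x - p.1 • p.2)) scaleMeasure := by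
  refine (integrable_avgKernel w L).mul_bdd (c := 1) ?_
    (Filter.Eventually.of_forall fun p => (norm_expo _ _).le)
  exact ((contDiff_expo (freq n)).continuous.comp (by fun_prop)).aestronglyMeasurable

theorem integral_avgKernel_mul_expo {w : List (Fin 2)} {L : ℕ} (hw : w.length < 2 * L)
    {n : Fin 2 → ℤ} (hn : n ≠ 0) (x : Plane) :
    ∫ p, avgKernel w L p * expo (freq n) (x - p.1 • p.2) ∂scaleMeasure =
      wordSym w n * invSym L n * expo (freq n) x := by
  have hi := integrable_avgKernel_mul w L n x
  rw [scaleMeasure] at hi ⊢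
  rw [integral_prod _ hi]
  simp only [avgKernel, mul_assoc _ (kern w _), integral_const_mul, integral_kern_mul_expo,
    cutSym_smul_freq]
  set c : ℝ := ((-(4 * Real.pi ^ 2)) ^ L)⁻¹ * (cutMass L)⁻¹ with hc
  have e : ∀ r : ℝ, ((c * r ^ (2 * L - 1 - w.length) : ℝ) : ℂ) * (expo (freq n) x *
      ((r : ℂ) ^ w.length * wordSym w n * ((cutoff (r ^ 2 * freqSq n) : ℝ) : ℂ))) =
      (wordSym w n * expo (freq n) x * c) *
        ((r ^ (2 * L - 1) * cutoff (r ^ 2 * freqSq n) : ℝ) : ℂ) := by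
    intro r
    have h : r ^ (2 * L - 1) = r ^ (2 * L - 1 - w.length) * r ^ w.length := by
      rw [← pow_add]; congr 1; omega
    rw [h]
    push_cast
    ring
  simp_rw [e]
  rw [integral_const_mul, integral_complex_ofReal, ← intervalIntegral.integral_of_le zero_le_one,
    integral_cutoff_scale (by omega) (one_le_freqSq hn), invSym, if_neg hn, neg_mul_eq_neg_mul,
    mul_pow, mul_inv, hc]
  have := (cutMass_pos L).ne'
  have h3 : ((cutMass L : ℝ) : ℂ) ≠ 0 := by exact_mod_cast this
  push_cast
  field_simp

/-- **Operators of negative order are averages of translates.** If `|w| < 2L` then `∂^w Δ^{-L} g` is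
the integral of translates of `g` against an integrable kernel that does not depend on `g`. -/
theorem exists_average {w : List (Fin 2)} {L : ℕ} (hw : w.length < 2 * L) :
    ∃ κ : ℝ × Plane → ℝ, Integrable κ scaleMeasure ∧ ∀ (g : PeriodicMeanZero) (x : Plane),
      (pdsP w (invPow L g) : Plane → ℝ) x =
        ∫ p, κ p * (g : Plane → ℝ) (x - p.1 • p.2) ∂scaleMeasure := by
  refine ⟨fun p => (avgKernel w L p).re, (integrable_avgKernel w L).re, fun g x => ?_⟩
  have hp := periodic_coe g
  have hg := contDiff_coe g
  have hr := rapid_coef hp hg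
  have hsum := hasSum_integral_of_summable_integral_norm (μ := scaleMeasure)
    (F := fun (n : Fin 2 → ℤ) p => coef g n * (avgKernel w L p * expo (freq n) (x - p.1 • p.2)))
    (fun n => (integrable_avgKernel_mul w L n x).const_mul _) (by
      simp only [norm_mul, norm_expo, mul_one, integral_const_mul]
      exact hr.summable_norm.mul_right _)
  have hpt (p : ℝ × Plane) :
      ∑' n, coef g n * (avgKernel w L p * expo (freq n) (x - p.1 • p.2)) =
        avgKernel w L p * (((g : Plane → ℝ) (x - p.1 • p.2) : ℝ) : ℂ) := by
    rw [ofReal_eq_trig_coef hp hg, trig, ← tsum_mul_left]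
    exact tsum_congr fun n => by ring
  have hterm (n : Fin 2 → ℤ) :
      ∫ p, coef g n * (avgKernel w L p * expo (freq n) (x - p.1 • p.2)) ∂scaleMeasure =
        wordSym w n * (invSym L n * coef g n) * expo (freq n) x := by
    rw [integral_const_mul]
    by_cases hn : n = 0
    · rw [hn, coef_zero_coe]; ring
    · rw [integral_avgKernel_mul_expo hw hn]; ring
  simp only [hpt, hterm] at hsum
  obtain ⟨-, h2⟩ := pds_re_trig w (hr.invSym_mul L)
  have h3 := congrFun h2 x
  rw [coe_pdsP, coe_invPow, invLap_eq_re_trig hp hg, h3, trig, hsum.tsum_eq]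
  have hi : Integrable (fun p => avgKernel w L p * (((g : Plane → ℝ) (x - p.1 • p.2) : ℝ) : ℂ))
      scaleMeasure := by
    obtain ⟨C, -, hC⟩ := hp.exists_bound hg.continuous
    refine (integrable_avgKernel w L).mul_bdd (c := C) ?_
      (Filter.Eventually.of_forall fun p => by simpa using hC _)
    exact (Complex.continuous_ofReal.comp
      (hg.continuous.comp (by fun_prop))).aestronglyMeasurable
  have h4 := Complex.reCLM.integral_comp_comm hi
  simp only [Complex.reCLM_apply, Complex.re_mul_ofReal] at h4
  exact h4.symm

end kernel

/-! ### Comparison of `L^s` norms -/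

section norms

open MeasureTheory

/-- If every integral of a function of `‖F‖` is at most `c` times the corresponding integral for
`‖G‖`, then the `L^s` norms compare with the factor `c^{1/s}`. -/
theorem eLpNorm_le_of_lintegral_comp_le {X Y E E' : Type*} [MeasurableSpace X] [MeasurableSpace Y]
    [NormedAddCommGroup E] [NormedAddCommGroup E'] {μ : Measure X} {ν : Measure Y} {F : X → E}
    {G : Y → E'} {c : ℝ≥0∞} (hF : Measurable fun x => ‖F x‖ₑ)
    (h : ∀ θ : ℝ≥0∞ → ℝ≥0∞, ∫⁻ x, θ ‖F x‖ₑ ∂μ ≤ c * ∫⁻ y, θ ‖G y‖ₑ ∂ν) {s : ℝ≥0∞} (hs : 1 ≤ s) :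
    eLpNorm F s μ ≤ c ^ (1 / s).toReal * eLpNorm G s ν := by
  have hs0 : s ≠ 0 := (zero_lt_one.trans_le hs).ne'
  rcases eq_or_ne s ∞ with rfl | hs1
  · simp only [ENNReal.div_top, ENNReal.toReal_zero, ENNReal.rpow_zero, one_mul,
      eLpNorm_exponent_top]
    -- the hypothesis applied to the indicator of the values above the essential supremum of `‖G‖`
    set θ : ℝ≥0∞ → ℝ≥0∞ := (Set.Ioi (eLpNormEssSup G ν)).indicator 1
    have hθ : Measurable θ := measurable_one.indicator measurableSet_Ioi
    have h0 : ∫⁻ y, θ ‖G y‖ₑ ∂ν = 0 := by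
      rw [← lintegral_zero (μ := ν)]
      refine lintegral_congr_ae ?_
      filter_upwards [enorm_ae_le_eLpNormEssSup G ν] with y hy
      simp [θ, hy]
    have h1 := h θ
    rw [h0, mul_zero, nonpos_iff_eq_zero,
      lintegral_eq_zero_iff (f := fun x => θ ‖F x‖ₑ) (hθ.comp hF)] at h1
    refine essSup_le_of_ae_le _ ?_
    filter_upwards [h1] with x hx
    by_contra hlt
    simp [θ, not_le.1 hlt] at hx
  · have hp : 0 < s.toReal := ENNReal.toReal_pos hs0 hs1
    rw [eLpNorm_eq_lintegral_rpow_enorm_toReal hs0 hs1,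
      eLpNorm_eq_lintegral_rpow_enorm_toReal hs0 hs1, ENNReal.toReal_div, ENNReal.toReal_one,
      ← ENNReal.mul_rpow_of_nonneg _ _ (by positivity)]
    exact ENNReal.rpow_le_rpow (h fun t => t ^ s.toReal) (by positivity)

theorem LatticePeriodic.comp {α β : Type*} {u : Plane → α} (hu : LatticePeriodic u) (φ : α → β) :
    LatticePeriodic fun x => φ (u x) := fun x i l => by simp only [hu x i l]

theorem toReal_two_div (s : ℝ≥0∞) : (2 / s).toReal = 2 * (1 / s).toReal := by
  rw [ENNReal.toReal_div, ENNReal.toReal_div]; simp; ring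

/-- The `L^s` norm of a periodic function over a ball of radius `R`. -/
theorem eLpNorm_closedBall_le {E : Type*} [NormedAddCommGroup E] {F : Plane → E}
    (hF : LatticePeriodic F) (hc : Continuous F) (x₀ : Plane) {R : ℝ} (hR : 0 ≤ R) {s : ℝ≥0∞}
    (hs : 1 ≤ s) : eLpNorm F s (volume.restrict (Metric.closedBall x₀ R)) ≤
      9 * ENNReal.ofReal (1 + R) ^ (2 / s).toReal * eLpNorm F s (volume.restrict unitCell) := by
  refine (eLpNorm_le_of_lintegral_comp_le hc.enorm.measurable
    (fun θ => lintegral_closedBall_le (hF.comp fun v => θ ‖v‖ₑ) x₀ hR) hs).trans ?_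
  gcongr
  have h1 : (1 / s).toReal ≤ 1 := by
    have : 1 / s ≤ 1 := ENNReal.div_le_of_le_mul (by simpa using hs)
    simpa using ENNReal.toReal_mono ENNReal.one_ne_top this
  rw [ENNReal.mul_rpow_of_nonneg _ _ ENNReal.toReal_nonneg, ← ENNReal.rpow_natCast_mul,
    toReal_two_div]
  have h9 : (9 : ℝ≥0∞) ^ (1 / s).toReal ≤ 9 := by
    simpa using ENNReal.rpow_le_rpow_of_exponent_le (x := 9) (by norm_num) h1
  push_cast
  gcongr

theorem eLpNorm_osc_le (lam : ℕ) (hl : 1 ≤ lam) {s : ℝ≥0∞} (hs : 1 ≤ s) (g : PeriodicMeanZero) :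
    eLpNorm (osc lam hl g : Plane → ℝ) s (volume.restrict unitCell) ≤
      1 * eLpNorm (g : Plane → ℝ) s (volume.restrict unitCell) := by
  have := eLpNorm_le_of_lintegral_comp_le (μ := volume.restrict unitCell)
    (ν := volume.restrict unitCell) (c := 1) (F := (osc lam hl g : Plane → ℝ)) (G := g)
    (contDiff_coe (osc lam hl g)).continuous.enorm.measurable
    (fun θ => by
      rw [one_mul]
      exact lintegral_unitCell_dilate_le ((periodic_coe g).comp fun v => θ ‖v‖ₑ) hl) hs
  simpa using this

/-- Everywhere, a continuous periodic function is bounded by its `L^∞` norm over the unit cell. -/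
theorem enorm_le_eLpNorm_top {E : Type*} [NormedAddCommGroup E] {F : Plane → E}
    (hF : LatticePeriodic F) (hc : Continuous F) (x : Plane) :
    ‖F x‖ₑ ≤ eLpNorm F ∞ (volume.restrict unitCell) := by
  set S := eLpNorm F ∞ (volume.restrict unitCell) with hS
  by_contra hlt
  have hx : x ∈ (fun y => ‖F y‖ₑ) ⁻¹' Set.Ioi S := not_le.1 hlt
  have hopen : IsOpen ((fun y => ‖F y‖ₑ) ⁻¹' Set.Ioi S) := isOpen_Ioi.preimage hc.enorm
  obtain ⟨ε, hε, hball⟩ := Metric.isOpen_iff.1 hopen x hx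
  -- the indicator of `{‖F‖ > S}` integrates to zero over the cell, hence over every ball
  have h2 := lintegral_closedBall_le
    (hF.comp fun v => (Set.Ioi S).indicator (1 : ℝ≥0∞ → ℝ≥0∞) ‖v‖ₑ) x (R := ε / 2) (by positivity)
  have h3 : ∫⁻ y in unitCell, (Set.Ioi S).indicator (1 : ℝ≥0∞ → ℝ≥0∞) ‖F y‖ₑ = 0 := by
    rw [← lintegral_zero (μ := volume.restrict unitCell)]
    refine lintegral_congr_ae ?_
    filter_upwards [enorm_ae_le_eLpNormEssSup F (volume.restrict unitCell)] with y hy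
    have hy' : ‖F y‖ₑ ∉ Set.Ioi S := not_lt.2 hy
    simp only [Set.indicator_of_notMem hy']
  have h4 : ∫⁻ y in Metric.closedBall x (ε / 2), (Set.Ioi S).indicator (1 : ℝ≥0∞ → ℝ≥0∞) ‖F y‖ₑ =
      volume (Metric.closedBall x (ε / 2)) := by
    rw [← setLIntegral_one]
    refine setLIntegral_congr_fun Metric.isClosed_closedBall.measurableSet fun y hy => ?_
    have : y ∈ Metric.ball x ε :=
      Metric.closedBall_subset_ball (by linarith) hy
    have h5 : S < ‖F y‖ₑ := hball this
    simp [h5]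
  rw [h3, h4, mul_zero, nonpos_iff_eq_zero] at h2
  exact (Metric.measure_closedBall_pos volume x (by positivity : 0 < ε / 2)).ne' h2

/-- Averages of translates against an integrable kernel are bounded on every `L^s(𝕋²)`, with the
`L¹` norm of the kernel as constant. -/
theorem eLpNorm_average_le {Ω : Type*} [MeasurableSpace Ω] {μ : Measure Ω} [SFinite μ] {κ : Ω → ℝ}
    (hκ : Integrable κ μ) {ξ : Ω → Plane} (hξ : Measurable ξ) {g : Plane → ℝ}
    (hp : LatticePeriodic g) (hg : Continuous g) {s : ℝ≥0∞} (hs : 1 ≤ s) :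
    eLpNorm (fun x => ∫ p, κ p * g (x - ξ p) ∂μ) s (volume.restrict unitCell) ≤
      (∫⁻ p, ‖κ p‖ₑ ∂μ) * eLpNorm g s (volume.restrict unitCell) := by
  have hs0 : s ≠ 0 := (zero_lt_one.trans_le hs).ne'
  set c := ∫⁻ p, ‖κ p‖ₑ ∂μ
  have hpt (x : Plane) : ‖∫ p, κ p * g (x - ξ p) ∂μ‖ₑ ≤ ∫⁻ p, ‖κ p‖ₑ * ‖g (x - ξ p)‖ₑ ∂μ := by
    simpa only [enorm_mul] using enorm_integral_le_lintegral_enorm (μ := μ)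
      fun p => κ p * g (x - ξ p)
  rcases eq_or_ne s ∞ with rfl | hs1
  · rw [eLpNorm_exponent_top]
    refine essSup_le_of_ae_le _ (Filter.Eventually.of_forall fun x => (hpt x).trans ?_)
    calc ∫⁻ p, ‖κ p‖ₑ * ‖g (x - ξ p)‖ₑ ∂μ
        ≤ ∫⁻ p, ‖κ p‖ₑ * eLpNorm g ∞ (volume.restrict unitCell) ∂μ := by
          gcongr; exact enorm_le_eLpNorm_top hp hg _
      _ = _ := lintegral_mul_const'' _ hκ.aestronglyMeasurable.enorm
  · have hpos : 0 < s.toReal := ENNReal.toReal_pos hs0 hs1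
    have hmeas (x : Plane) : Measurable fun p => ‖g (x - ξ p)‖ₑ :=
      hg.enorm.measurable.comp (measurable_const.sub hξ)
    have hκm : AEMeasurable (fun p => ‖κ p‖ₑ) μ := hκ.aestronglyMeasurable.enorm
    -- Jensen's inequality for the measure with density `‖κ‖`
    have hJ (x : Plane) : ‖∫ p, κ p * g (x - ξ p) ∂μ‖ₑ ^ s.toReal ≤
        c ^ (s.toReal - 1) * ∫⁻ p, ‖κ p‖ₑ * ‖g (x - ξ p)‖ₑ ^ s.toReal ∂μ := by
      have h1 := eLpNorm_le_eLpNorm_mul_rpow_measure_univ (μ := μ.withDensity fun p => ‖κ p‖ₑ) hs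
        (f := fun p => g (x - ξ p))
        (hg.measurable.comp (measurable_const.sub hξ)).aestronglyMeasurable
      rw [eLpNorm_one_eq_lintegral_enorm, eLpNorm_eq_lintegral_rpow_enorm_toReal hs0 hs1,
        lintegral_withDensity_eq_lintegral_mul₀ hκm (hmeas x).aemeasurable,
        lintegral_withDensity_eq_lintegral_mul₀ hκm ((hmeas x).pow_const _).aemeasurable,
        withDensity_apply _ MeasurableSet.univ, Measure.restrict_univ] at h1
      have h2 := ENNReal.rpow_le_rpow ((hpt x).trans h1) hpos.le
      refine h2.trans_eq ?_
      rw [ENNReal.mul_rpow_of_nonneg _ _ hpos.le, ← ENNReal.rpow_mul, ← ENNReal.rpow_mul,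
        one_div_mul_cancel hpos.ne', ENNReal.rpow_one, mul_comm, ENNReal.toReal_one]
      congr 2
      field_simp
    have hjoint : AEMeasurable (Function.uncurry fun (x : Plane) p =>
        ‖κ p‖ₑ * ‖g (x - ξ p)‖ₑ ^ s.toReal) ((volume.restrict unitCell).prod μ) := by
      refine AEMeasurable.mul (hκm.comp_snd) ?_
      exact ((hg.enorm.measurable.comp (measurable_fst.sub (hξ.comp measurable_snd))).pow_const
        _).aemeasurable
    rw [eLpNorm_eq_lintegral_rpow_enorm_toReal hs0 hs1,
      eLpNorm_eq_lintegral_rpow_enorm_toReal hs0 hs1]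
    have hc : c = (c ^ s.toReal) ^ (1 / s.toReal) := by
      rw [← ENNReal.rpow_mul, mul_one_div_cancel hpos.ne', ENNReal.rpow_one]
    rw [hc, ← ENNReal.mul_rpow_of_nonneg _ _ (by positivity)]
    refine ENNReal.rpow_le_rpow ?_ (by positivity)
    have hs2 : 0 ≤ s.toReal - 1 := by
      have := ENNReal.toReal_mono hs1 hs
      rw [ENNReal.toReal_one] at this
      linarith
    have hfin : c ^ (s.toReal - 1) ≠ ⊤ := by
      exact ENNReal.rpow_ne_top_of_nonneg hs2 hκ.2.ne
    calc ∫⁻ x in unitCell, ‖∫ p, κ p * g (x - ξ p) ∂μ‖ₑ ^ s.toReal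
        ≤ ∫⁻ x in unitCell, c ^ (s.toReal - 1) *
            (∫⁻ p, ‖κ p‖ₑ * ‖g (x - ξ p)‖ₑ ^ s.toReal ∂μ) := lintegral_mono fun x => hJ x
      _ = c ^ (s.toReal - 1) * ∫⁻ p, (∫⁻ x in unitCell,
            ‖κ p‖ₑ * ‖g (x - ξ p)‖ₑ ^ s.toReal) ∂μ := by
          rw [lintegral_const_mul' _ _ hfin, lintegral_lintegral_swap hjoint]
      _ = c ^ (s.toReal - 1) * ∫⁻ p, ‖κ p‖ₑ * (∫⁻ x in unitCell, ‖g x‖ₑ ^ s.toReal) ∂μ := by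
          congr 1
          refine lintegral_congr fun p => ?_
          rw [lintegral_const_mul' _ _ enorm_ne_top]
          congr 1
          simpa only [sub_eq_add_neg] using
            lintegral_unitCell_add (hp.comp fun v => ‖v‖ₑ ^ s.toReal) (-ξ p)
      _ = c ^ s.toReal * ∫⁻ x in unitCell, ‖g x‖ₑ ^ s.toReal := by
          rw [lintegral_mul_const'' _ hκm, ← mul_assoc]
          congr 1
          have h6 := ENNReal.rpow_add_of_nonneg (x := c) _ _ hs2 zero_le_one
          rw [sub_add_cancel, ENNReal.rpow_one] at h6
          exact h6.symm

end norms

/-! ### Sobolev norms -/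

section sobolev

open MeasureTheory

theorem ContDiff.continuous_iteratedFDeriv_of_infty {u : Plane → ℝ} (hu : ContDiff ℝ ∞ u) (j : ℕ) :
    Continuous (iteratedFDeriv ℝ j u) :=
  hu.continuous_iteratedFDeriv (by exact_mod_cast le_top)

theorem eLpNorm_iteratedFDeriv_zero (u : Plane → ℝ) (s : ℝ≥0∞) (μ : Measure Plane) :
    eLpNorm (fun x => iteratedFDeriv ℝ 0 u x) s μ = eLpNorm u s μ :=
  eLpNorm_congr_norm_ae (Filter.Eventually.of_forall fun _ => norm_iteratedFDeriv_zero)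

theorem eLpNorm_iteratedFDeriv_succ_le {u : Plane → ℝ} (hu : ContDiff ℝ ∞ u) (j : ℕ) {s : ℝ≥0∞}
    (hs : 1 ≤ s) (μ : Measure Plane) :
    eLpNorm (fun x => iteratedFDeriv ℝ (j + 1) u x) s μ ≤
      ∑ i, eLpNorm (fun x => iteratedFDeriv ℝ j (pd i u) x) s μ := by
  refine (eLpNorm_mono_real (norm_iteratedFDeriv_succ_le hu j)).trans ?_
  have e : (fun x => ∑ i, ‖iteratedFDeriv ℝ j (pd i u) x‖) =
      ∑ i, fun x => ‖iteratedFDeriv ℝ j (pd i u) x‖ := by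
    funext x; simp
  rw [e]
  refine (eLpNorm_sum_le (fun i _ => ?_) hs).trans_eq ?_
  · exact ((hu.pd i).continuous_iteratedFDeriv_of_infty j).norm.aestronglyMeasurable
  · exact Finset.sum_congr rfl fun i _ => eLpNorm_norm _

theorem eLpNorm_iteratedFDeriv_pd_le {u : Plane → ℝ} (hu : ContDiff ℝ ∞ u) (i : Fin 2) (j : ℕ)
    (s : ℝ≥0∞) (μ : Measure Plane) :
    eLpNorm (fun x => iteratedFDeriv ℝ j (pd i u) x) s μ ≤
      eLpNorm (fun x => iteratedFDeriv ℝ (j + 1) u x) s μ :=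
  eLpNorm_mono (norm_iteratedFDeriv_pd_le hu i j)

theorem eLpNorm_iteratedFDeriv_smul {u : Plane → ℝ} (hu : ContDiff ℝ ∞ u) (c : ℝ) (j : ℕ)
    (s : ℝ≥0∞) (μ : Measure Plane) :
    eLpNorm (fun x => iteratedFDeriv ℝ j (c • u) x) s μ =
      ‖c‖ₑ * eLpNorm (fun x => iteratedFDeriv ℝ j u x) s μ := by
  have e : (fun x => iteratedFDeriv ℝ j (c • u) x) = c • fun x => iteratedFDeriv ℝ j u x := by
    funext x
    exact iteratedFDeriv_const_smul_apply ((hu.of_le (by exact_mod_cast le_top)).contDiffAt)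
  rw [e, eLpNorm_const_smul]

/-- An operator that is bounded on `L^s(𝕋²)` and commutes with the partial derivatives up to the
factor `c` is bounded on the homogeneous Sobolev seminorms. -/
theorem eLpNorm_iteratedFDeriv_op_le {T : PeriodicMeanZero → PeriodicMeanZero} {c : ℝ≥0}
    (hT : ∀ i g, pdP i (T g) = (c : ℝ) • T (pdP i g)) {s C : ℝ≥0∞} (hs : 1 ≤ s)
    (h0 : ∀ g : PeriodicMeanZero, eLpNorm (T g : Plane → ℝ) s (volume.restrict unitCell) ≤
      C * eLpNorm (g : Plane → ℝ) s (volume.restrict unitCell)) (j : ℕ) (g : PeriodicMeanZero) :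
    eLpNorm (fun x => iteratedFDeriv ℝ j (T g : Plane → ℝ) x) s (volume.restrict unitCell) ≤
      (2 * c) ^ j * C *
        eLpNorm (fun x => iteratedFDeriv ℝ j (g : Plane → ℝ) x) s (volume.restrict unitCell) := by
  induction j generalizing g with
  | zero => simpa [eLpNorm_iteratedFDeriv_zero] using h0 g
  | succ j ih =>
    refine (eLpNorm_iteratedFDeriv_succ_le (contDiff_coe (T g)) j hs _).trans ?_
    calc ∑ i, eLpNorm (fun x => iteratedFDeriv ℝ j (pd i (T g : Plane → ℝ)) x) s
          (volume.restrict unitCell)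
        ≤ ∑ i : Fin 2, c * ((2 * c) ^ j * C * eLpNorm (fun x => iteratedFDeriv ℝ (j + 1)
            (g : Plane → ℝ) x) s (volume.restrict unitCell)) := by
          refine Finset.sum_le_sum fun i _ => ?_
          rw [← coe_pdP, hT, Submodule.coe_smul,
            eLpNorm_iteratedFDeriv_smul (contDiff_coe _), NNReal.enorm_eq]
          gcongr
          refine (ih _).trans ?_
          gcongr
          exact eLpNorm_iteratedFDeriv_pd_le (contDiff_coe g) i j s _
      _ = _ := by
          rw [Finset.sum_const, Finset.card_univ, Fintype.card_fin, pow_succ, nsmul_eq_mul]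
          push_cast
          ring

theorem pdP_pdsP_invPow (i : Fin 2) (w : List (Fin 2)) (L : ℕ) (g : PeriodicMeanZero) :
    pdP i (pdsP w (invPow L g)) = pdsP w (invPow L (pdP i g)) := by
  rw [pdP_pdsP, pdP_invPow]

/-- Operators `∂^w Δ^{-L}` of negative order are bounded on every `L^s(𝕋²)`, uniformly in `s`, and
for the supremum norm. -/
theorem exists_eLpNorm_pdsP_invPow_le {w : List (Fin 2)} {L : ℕ} (hw : w.length < 2 * L) :
    ∃ C : ℝ≥0, (∀ s : ℝ≥0∞, 1 ≤ s → ∀ g : PeriodicMeanZero,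
      eLpNorm (pdsP w (invPow L g) : Plane → ℝ) s (volume.restrict unitCell) ≤
        C * eLpNorm (g : Plane → ℝ) s (volume.restrict unitCell)) ∧
      ∀ (g : PeriodicMeanZero) (A : ℝ), (∀ x, |(g : Plane → ℝ) x| ≤ A) →
        ∀ x, |(pdsP w (invPow L g) : Plane → ℝ) x| ≤ C * A := by
  obtain ⟨κ, hκ, h⟩ := exists_average hw
  refine ⟨(∫⁻ p, ‖κ p‖ₑ ∂scaleMeasure).toNNReal, fun s hs g => ?_, fun g A hA x => ?_⟩
  · rw [ENNReal.coe_toNNReal hκ.2.ne]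
    have e : (pdsP w (invPow L g) : Plane → ℝ) = _ := funext fun x => h g x
    rw [e]
    exact eLpNorm_average_le hκ (ξ := fun p : ℝ × Plane => p.1 • p.2)
      (by fun_prop) (periodic_coe g) (contDiff_coe g).continuous hs
  · rw [h g x]
    have e : (((∫⁻ p, ‖κ p‖ₑ ∂scaleMeasure).toNNReal : ℝ≥0) : ℝ) = ∫ p, ‖κ p‖ ∂scaleMeasure := by
      rw [integral_norm_eq_lintegral_enorm hκ.1]; rfl
    rw [e, ← integral_mul_const, ← Real.norm_eq_abs]
    refine norm_integral_le_of_norm_le (hκ.norm.mul_const A)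
      (Filter.Eventually.of_forall fun p => ?_)
    rw [norm_mul]
    gcongr
    exact hA _

theorem sobolevNormTorus_op_le {T : PeriodicMeanZero → PeriodicMeanZero} {c : ℝ≥0} (hc : 1 ≤ c)
    (hT : ∀ i g, pdP i (T g) = (c : ℝ) • T (pdP i g)) {s C : ℝ≥0∞} (hs : 1 ≤ s)
    (h0 : ∀ g : PeriodicMeanZero, eLpNorm (T g : Plane → ℝ) s (volume.restrict unitCell) ≤
      C * eLpNorm (g : Plane → ℝ) s (volume.restrict unitCell)) (m : ℕ) (g : PeriodicMeanZero) :
    sobolevNormTorus m s (T g : Plane → ℝ) ≤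
      (2 * c) ^ m * C * sobolevNormTorus m s (g : Plane → ℝ) := by
  unfold sobolevNormTorus sobolevNorm
  rw [Finset.mul_sum]
  refine Finset.sum_le_sum fun j hj => (eLpNorm_iteratedFDeriv_op_le hT hs h0 j g).trans ?_
  gcongr
  · have : (1 : ℝ≥0∞) ≤ c := by exact_mod_cast hc
    calc (1 : ℝ≥0∞) ≤ 2 * 1 := by norm_num
      _ ≤ 2 * c := by gcongr
  · exact Nat.lt_succ_iff.1 (Finset.mem_range.1 hj)

theorem sobolevNormTorus_mono {m m' : ℕ} (h : m ≤ m') (s : ℝ≥0∞) (u : Plane → ℝ) :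
    sobolevNormTorus m s u ≤ sobolevNormTorus m' s u :=
  Finset.sum_le_sum_of_subset (Finset.range_mono (by omega))

/-- Operators of negative order, and the identity, are bounded on `W^{m,s}(𝕋²)`. -/
theorem exists_sobolevNormTorus_le {w : List (Fin 2)} {L : ℕ}
    (hw : w.length < 2 * L ∨ w = [] ∧ L = 0) (m : ℕ) :
    ∃ C : ℝ≥0, ∀ s : ℝ≥0∞, 1 ≤ s → ∀ g : PeriodicMeanZero,
      sobolevNormTorus m s (pdsP w (invPow L g) : Plane → ℝ) ≤
        C * sobolevNormTorus m s (g : Plane → ℝ) := by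
  rcases hw with hw | ⟨rfl, rfl⟩
  · obtain ⟨C, hC, -⟩ := exists_eLpNorm_pdsP_invPow_le hw
    refine ⟨2 ^ m * C, fun s hs g => ?_⟩
    have := sobolevNormTorus_op_le (T := fun g => pdsP w (invPow L g)) (c := 1) le_rfl
      (fun i g => by rw [pdP_pdsP_invPow]; simp) hs (hC s hs) m g
    simpa using this
  · exact ⟨1, fun s _ g => by simp⟩

/-- Operators `∂^w Δ^{-L}` of order at most zero lose at most one derivative on `W^{m,s}(𝕋²)`. -/
theorem exists_sobolevNormTorus_le_succ {w : List (Fin 2)} {L : ℕ} (hw : w.length ≤ 2 * L)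
    (m : ℕ) :
    ∃ C : ℝ≥0, ∀ s : ℝ≥0∞, 1 ≤ s → ∀ g : PeriodicMeanZero,
      sobolevNormTorus m s (pdsP w (invPow L g) : Plane → ℝ) ≤
        C * sobolevNormTorus (m + 1) s (g : Plane → ℝ) := by
  cases w with
  | nil =>
    obtain ⟨C, hC⟩ := exists_sobolevNormTorus_le (w := []) (L := L)
      (by rcases Nat.eq_zero_or_pos L with h | h
          · exact Or.inr ⟨rfl, h⟩
          · exact Or.inl (by simpa using h)) m
    exact ⟨C, fun s hs g => (hC s hs g).trans
      (by gcongr; exact sobolevNormTorus_mono (by omega) _ _)⟩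
  | cons i w =>
    have hw' : w.length < 2 * L := by simpa [Nat.succ_le_iff] using hw
    obtain ⟨C, hC⟩ := exists_sobolevNormTorus_le (Or.inl hw') m
    refine ⟨C, fun s hs g => ?_⟩
    -- one derivative is moved from the operator onto `g`
    rw [pdsP_cons, pdP_pdsP_invPow]
    refine (hC s hs _).trans ?_
    gcongr
    unfold sobolevNormTorus sobolevNorm
    rw [Finset.sum_range_succ' _ (m + 1)]
    refine le_trans (Finset.sum_le_sum fun j _ => ?_) le_self_add
    exact eLpNorm_iteratedFDeriv_pd_le (contDiff_coe g) i j s _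

/-- A negative power of the Laplacian gains one derivative. -/
theorem exists_sobolevNormTorus_succ_le {k : ℕ} (hk : 1 ≤ k) (m : ℕ) :
    ∃ C : ℝ≥0, ∀ s : ℝ≥0∞, 1 ≤ s → ∀ g : PeriodicMeanZero,
      sobolevNormTorus (m + 1) s (invPow k g : Plane → ℝ) ≤
        C * sobolevNormTorus m s (g : Plane → ℝ) := by
  obtain ⟨C₀, h₀⟩ := exists_sobolevNormTorus_le (w := []) (L := k) (Or.inl (by simp; omega)) m
  have h (i : Fin 2) := exists_sobolevNormTorus_le (w := [i]) (L := k) (Or.inl (by simp; omega)) m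
  choose C hC using h
  refine ⟨C₀ + ∑ i, C i, fun s hs g => ?_⟩
  have h1 : sobolevNormTorus (m + 1) s (invPow k g : Plane → ℝ) ≤
      sobolevNormTorus m s (invPow k g : Plane → ℝ) +
        ∑ i, sobolevNormTorus m s (pdsP [i] (invPow k g) : Plane → ℝ) := by
    unfold sobolevNormTorus sobolevNorm
    rw [Finset.sum_range_succ', add_comm]
    refine add_le_add ?_ ?_
    · rw [Finset.sum_range_succ']; exact le_add_self
    · rw [Finset.sum_comm]
      exact Finset.sum_le_sum fun j _ =>
        eLpNorm_iteratedFDeriv_succ_le (contDiff_coe _) j hs _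
  refine h1.trans ?_
  push_cast
  rw [add_mul, Finset.sum_mul]
  exact add_le_add (h₀ s hs g) (Finset.sum_le_sum fun i _ => hC i s hs g)

/-- Negative powers of the Laplacian of an oscillating function. -/
theorem exists_sobolevNormTorus_invPow_osc_le (m : ℕ) :
    ∃ C : ℝ≥0, ∀ (k : ℕ) (s : ℝ≥0∞), 1 ≤ s → ∀ (lam : ℕ) (hl : 1 ≤ lam) (g : PeriodicMeanZero),
      sobolevNormTorus m s (invPow k (osc lam hl g) : Plane → ℝ) ≤
        C * (lam : ℝ≥0∞) ^ (-(2 * k : ℤ) + (m : ℤ)) *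
          sobolevNormTorus m s (invPow k g : Plane → ℝ) := by
  refine ⟨2 ^ m, fun k s hs lam hl g => ?_⟩
  have h0 : (lam : ℝ≥0) ≠ 0 := by positivity
  have h0' : (lam : ℝ≥0∞) ≠ 0 := by exact_mod_cast h0
  have hsm : sobolevNormTorus m s (invPow k (osc lam hl g) : Plane → ℝ) =
      (((lam : ℝ≥0) ^ (2 * k))⁻¹ : ℝ≥0) *
        sobolevNormTorus m s (osc lam hl (invPow k g) : Plane → ℝ) := by
    rw [invPow_osc]
    unfold sobolevNormTorus sobolevNorm
    rw [Finset.mul_sum]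
    refine Finset.sum_congr rfl fun j _ => ?_
    refine (eLpNorm_iteratedFDeriv_smul (contDiff_coe _) _ j s _).trans ?_
    rw [← NNReal.enorm_eq]
    push_cast
    rfl
  have hop := sobolevNormTorus_op_le (T := osc lam hl) (c := lam) (by exact_mod_cast hl)
      (fun i g => by rw [pdP_osc]; simp) hs (eLpNorm_osc_le lam hl hs) m (invPow k g)
  rw [hsm]
  refine (mul_le_mul_right hop _).trans_eq ?_
  rw [ENNReal.zpow_add h0' (ENNReal.natCast_ne_top _), ENNReal.coe_inv (by positivity)]
  have h2 : (lam : ℝ≥0∞) ^ (-(2 * k : ℤ)) = ((lam : ℝ≥0∞) ^ (2 * k))⁻¹ := by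
    rw [← zpow_natCast, ← ENNReal.zpow_neg]; push_cast; rfl
  rw [h2, zpow_natCast]
  push_cast
  rw [mul_pow]
  ring

/-- The product of a test function with a periodic function: the supremum norms fall on the test
function, and its support is covered by `O((1 + R)²)` periods. -/
theorem sobolevNormPlane_mul_le (m : ℕ) {a : List (Fin 2)} {A : ℕ} (ha : a.length ≤ A)
    {s : ℝ≥0∞} (hs : 1 ≤ s) {f : Plane → ℝ} (hf : ContDiff ℝ ∞ f) {x₀ : Plane} {R : ℝ}
    (hR : 0 ≤ R) (hsupp : tsupport f ⊆ Metric.closedBall x₀ R) {u : Plane → ℝ}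
    (hp : LatticePeriodic u) (hu : ContDiff ℝ ∞ u) :
    sobolevNormPlane m s (pds a f * u) ≤
      ((m + 1) * 2 ^ m * 9 : ℕ) * ENNReal.ofReal (1 + R) ^ (2 / s).toReal * cNorm (A + m) f *
        sobolevNormTorus m s u := by
  set K := cNorm (A + m) f
  have hfK (i : ℕ) (hi : i ≤ m) (x : Plane) : ‖iteratedFDeriv ℝ i (pds a f) x‖ₑ ≤ K := by
    have h1 : ‖iteratedFDeriv ℝ i (pds a f) x‖ₑ ≤ ‖iteratedFDeriv ℝ (i + a.length) f x‖ₑ := by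
      rw [enorm_le_iff_norm_le]
      exact norm_iteratedFDeriv_pds_le hf a i x
    refine h1.trans ((le_iSup (fun x => ‖iteratedFDeriv ℝ (i + a.length) f x‖ₑ) x).trans ?_)
    exact Finset.single_le_sum (f := fun j => ⨆ x, ‖iteratedFDeriv ℝ j f x‖ₑ)
      (fun _ _ => zero_le) (Finset.mem_range.2 (by omega))
  have hterm (n : ℕ) (hn : n ≤ m) :
      eLpNorm (fun x => iteratedFDeriv ℝ n (pds a f * u) x) s volume ≤
        (2 ^ m * K) * (9 * ENNReal.ofReal (1 + R) ^ (2 / s).toReal * sobolevNormTorus m s u) := by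
    set B := Metric.closedBall x₀ R
    have hB : Function.support (fun x => iteratedFDeriv ℝ n (pds a f * u) x) ⊆ B := by
      refine (support_iteratedFDeriv_subset n).trans (subset_trans ?_ hsupp)
      exact (tsupport_mul_subset_left).trans (tsupport_pds_subset f a)
    rw [← eLpNorm_restrict_eq_of_support_subset hB]
    set H : Plane → ℝ := ∑ i ∈ Finset.range (n + 1), fun x => ‖iteratedFDeriv ℝ i u x‖
    have hcont (i : ℕ) : Continuous fun x => ‖iteratedFDeriv ℝ i u x‖ :=
      (hu.continuous_iteratedFDeriv_of_infty i).norm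
    have hHm : AEStronglyMeasurable H (volume.restrict B) := by
      refine Continuous.aestronglyMeasurable ?_
      have e : H = fun x => ∑ i ∈ Finset.range (n + 1), ‖iteratedFDeriv ℝ i u x‖ := by
        funext x; simp [H]
      rw [e]
      exact continuous_finsetSum _ fun i _ => hcont i
    have hpt (x : Plane) : ‖iteratedFDeriv ℝ n (pds a f * u) x‖ₑ ≤ (2 ^ m * K) * ‖H x‖ₑ := by
      have h1 := norm_iteratedFDeriv_mul_le (hf.pds a) hu x (n := n) (by exact_mod_cast le_top)
      have h2 : ‖iteratedFDeriv ℝ n (pds a f * u) x‖ₑ ≤ ∑ i ∈ Finset.range (n + 1),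
          (n.choose i : ℝ≥0∞) * ‖iteratedFDeriv ℝ i (pds a f) x‖ₑ *
            ‖iteratedFDeriv ℝ (n - i) u x‖ₑ := by
        have h3 := ENNReal.ofReal_le_ofReal h1
        rw [ofReal_norm, ENNReal.ofReal_sum_of_nonneg fun i _ => by positivity] at h3
        refine h3.trans_eq (Finset.sum_congr rfl fun i _ => ?_)
        rw [ENNReal.ofReal_mul (by positivity), ENNReal.ofReal_mul (by positivity),
          ENNReal.ofReal_natCast, ofReal_norm, ofReal_norm]
      have hHx : ‖H x‖ₑ = ∑ i ∈ Finset.range (n + 1), ‖iteratedFDeriv ℝ i u x‖ₑ := by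
        have h4 : H x = ∑ i ∈ Finset.range (n + 1), ‖iteratedFDeriv ℝ i u x‖ := by simp [H]
        rw [h4, Real.enorm_of_nonneg (Finset.sum_nonneg fun i _ => norm_nonneg _),
          ENNReal.ofReal_sum_of_nonneg fun i _ => norm_nonneg _]
        simp
      refine h2.trans ?_
      rw [hHx, ← Finset.sum_range_reflect, Finset.mul_sum]
      refine Finset.sum_le_sum fun i hi => ?_
      have hi' : i ≤ n := Nat.lt_succ_iff.1 (Finset.mem_range.1 hi)
      have e : n + 1 - 1 - i = n - i := by omega
      have e' : n - (n - i) = i := by omega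
      rw [e, e', Nat.choose_symm hi']
      gcongr
      · calc (n.choose i : ℝ≥0∞) ≤ ((2 ^ m : ℕ) : ℝ≥0∞) := by
              have : n.choose i ≤ 2 ^ m :=
                (Nat.choose_le_two_pow n i).trans (Nat.pow_le_pow_right (by norm_num) hn)
              exact_mod_cast this
          _ = 2 ^ m := by push_cast; rfl
      · exact hfK (n - i) (by omega) x
    refine (eLpNorm_le_mul_eLpNorm_of_ae_le_mul'' s hHm (Filter.Eventually.of_forall hpt)).trans ?_
    gcongr
    refine (eLpNorm_sum_le (fun i _ => (hcont i).aestronglyMeasurable) hs).trans ?_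
    calc ∑ i ∈ Finset.range (n + 1), eLpNorm (fun x => ‖iteratedFDeriv ℝ i u x‖) s
          (volume.restrict B)
        ≤ ∑ i ∈ Finset.range (n + 1), 9 * ENNReal.ofReal (1 + R) ^ (2 / s).toReal *
          eLpNorm (fun x => iteratedFDeriv ℝ i u x) s (volume.restrict unitCell) :=
          Finset.sum_le_sum fun i _ => by
            rw [eLpNorm_norm]
            exact eLpNorm_closedBall_le (hp.iteratedFDeriv i)
              (hu.continuous_iteratedFDeriv_of_infty i) x₀ hR hs
      _ = 9 * ENNReal.ofReal (1 + R) ^ (2 / s).toReal * sobolevNormTorus n s u := by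
          rw [← Finset.mul_sum]; rfl
      _ ≤ _ := by gcongr; exact sobolevNormTorus_mono hn s u
  unfold sobolevNormPlane sobolevNorm
  rw [Measure.restrict_univ]
  refine (Finset.sum_le_card_nsmul _ _ _ fun n hn =>
    hterm n (Nat.lt_succ_iff.1 (Finset.mem_range.1 hn))).trans_eq ?_
  rw [Finset.card_range, nsmul_eq_mul]
  push_cast
  ring

end sobolev

/-! ### Bilinear operators built from products of derivatives -/

theorem contDiff_coe_testFun (f : TestFun) : ContDiff ℝ ∞ (f : Plane → ℝ) := f.2.1

/-- Bilinear maps `C_c^∞(ℝ²) × C_0^∞(𝕋²) → C_c^∞(ℝ²)`. -/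
abbrev BilinOp : Type := TestFun →ₗ[ℝ] PeriodicMeanZero →ₗ[ℝ] TestFun

/-- Partial derivatives on test functions. -/
noncomputable def pdT (i : Fin 2) : TestFun →ₗ[ℝ] TestFun where
  toFun f := ⟨pd i f, (contDiff_coe_testFun f).pd i,
    f.2.2.mono' ((subset_tsupport _).trans (tsupport_pd_subset _ i))⟩
  map_add' f g := Subtype.ext (pd_add (contDiff_coe_testFun f) (contDiff_coe_testFun g) i)
  map_smul' c f := Subtype.ext (pd_const_smul (contDiff_coe_testFun f) c i)

@[simp] theorem coe_pdT (i : Fin 2) (f : TestFun) : (pdT i f : Plane → ℝ) = pd i f := rfl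

/-- Iterated partial derivatives on test functions. -/
noncomputable def pdsT : List (Fin 2) → TestFun →ₗ[ℝ] TestFun
  | [] => LinearMap.id
  | i :: w => pdT i ∘ₗ pdsT w

theorem coe_pdsT (w : List (Fin 2)) (f : TestFun) : (pdsT w f : Plane → ℝ) = pds w f := by
  induction w with
  | nil => rfl
  | cons i w ih => rw [pds_cons, ← ih]; rfl

/-- The Laplacian on test functions. -/
noncomputable def lapT : TestFun →ₗ[ℝ] TestFun := ∑ i, pdT i ∘ₗ pdT i

theorem coe_lapT (f : TestFun) : (lapT f : Plane → ℝ) = lap f := by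
  rw [lap_eq (contDiff_coe_testFun f)]
  simp [lapT]

/-- The product of a test function and a periodic function, as a bilinear map. -/
noncomputable def mulTP : BilinOp :=
  LinearMap.mk₂ ℝ
    (fun f g => ⟨(f : Plane → ℝ) * g, (contDiff_coe_testFun f).mul (contDiff_coe g),
      f.2.2.mul_right⟩)
    (fun _ _ _ => Subtype.ext (add_mul _ _ _))
    (fun _ _ _ => Subtype.ext (smul_mul_assoc _ _ _))
    (fun _ _ _ => Subtype.ext (mul_add _ _ _))
    (fun _ _ _ => Subtype.ext (mul_smul_comm _ _ _))

theorem pdT_mulTP (i : Fin 2) (f : TestFun) (g : PeriodicMeanZero) :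
    pdT i (mulTP f g) = mulTP (pdT i f) g + mulTP f (pdP i g) :=
  Subtype.ext (pd_mul (contDiff_coe_testFun f) (contDiff_coe g) i)

/-- The elementary operator `(f, g) ↦ ∂^a f · ∂^b Δ^{-k} g`. -/
noncomputable def elem (a b : List (Fin 2)) (k : ℕ) : BilinOp :=
  mulTP.compl₁₂ (pdsT a) (pdsP b ∘ₗ invPow k)

theorem elem_apply (a b : List (Fin 2)) (k : ℕ) (f : TestFun) (g : PeriodicMeanZero) :
    elem a b k f g = mulTP (pdsT a f) (pdsP b (invPow k g)) := rfl

theorem coe_elem (a b : List (Fin 2)) (k : ℕ) (f : TestFun) (g : PeriodicMeanZero) :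
    (elem a b k f g : Plane → ℝ) =
      pds a (f : Plane → ℝ) * (pdsP b (invPow k g) : Plane → ℝ) := by
  rw [← coe_pdsT]; rfl

/-- Composition of a bilinear operator with the Laplacian. -/
noncomputable def postLap : Module.End ℝ BilinOp where
  toFun T := T.compr₂ lapT
  map_add' S T := by ext f g : 2; simp
  map_smul' c T := by ext f g : 2; simp

@[simp] theorem postLap_apply (T : BilinOp) (f : TestFun) (g : PeriodicMeanZero) :
    postLap T f g = lapT (T f g) := rfl

theorem coe_postLap_pow (j : ℕ) (T : BilinOp) (f : TestFun) (g : PeriodicMeanZero) :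
    ((postLap ^ j) T f g : Plane → ℝ) = lap^[j] (T f g : Plane → ℝ) := by
  induction j with
  | zero => rfl
  | succ j ih =>
    rw [pow_succ', Module.End.mul_apply, postLap_apply, coe_lapT, ih, Function.iterate_succ_apply']

/-- The Leibniz rule for the Laplacian of an elementary operator. -/
theorem postLap_elem (a b : List (Fin 2)) (k : ℕ) :
    postLap (elem a b k) = ∑ i, (elem a (i :: i :: b) k + (2 : ℝ) • elem (i :: a) (i :: b) k +
      elem (i :: i :: a) b k) := by
  ext f g : 2
  simp only [postLap_apply, lapT, LinearMap.sum_apply, LinearMap.comp_apply, LinearMap.add_apply,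
    LinearMap.smul_apply, elem_apply, pdT_mulTP, map_add, pdsT, pdsP_cons]
  refine Finset.sum_congr rfl fun i _ => ?_
  module

/-- Two derivatives `∂_i ∂_i` summed over `i` cancel one inverse Laplacian. -/
theorem sum_elem_cons_cons (a b : List (Fin 2)) (k : ℕ) :
    ∑ i, elem a (i :: i :: b) (k + 1) = elem a b k := by
  ext f g : 2
  simp only [LinearMap.sum_apply, elem_apply, ← map_sum]
  congr 1
  have h (h : PeriodicMeanZero) : ∑ i, pdsP (i :: i :: b) h = pdsP b (lapP h) := by
    simp only [pdsP_cons, lapP, LinearMap.sum_apply, LinearMap.comp_apply, map_sum, pdP_pdsP]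
  rw [h, lapP_invPow_succ]

/-- The span of the elementary operators `∂^a f · ∂^b Δ^{-K} g` with `|a| ≤ A` and `|b| < β`. -/
noncomputable def elemSpan (A β K : ℕ) : Submodule ℝ BilinOp :=
  Submodule.span ℝ {T | ∃ a b, a.length ≤ A ∧ b.length < β ∧ T = elem a b K}

theorem elem_mem_elemSpan {a b : List (Fin 2)} {A β : ℕ} (K : ℕ) (ha : a.length ≤ A)
    (hb : b.length < β) : elem a b K ∈ elemSpan A β K :=
  Submodule.subset_span ⟨a, b, ha, hb, rfl⟩

theorem elemSpan_mono {A A' β β' : ℕ} (hA : A ≤ A') (hβ : β ≤ β') (K : ℕ) :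
    elemSpan A β K ≤ elemSpan A' β' K :=
  Submodule.span_mono fun _ ⟨a, b, ha, hb, h⟩ => ⟨a, b, ha.trans hA, hb.trans_le hβ, h⟩

theorem postLap_mem_elemSpan {A β K : ℕ} {T : BilinOp} (hT : T ∈ elemSpan A β K) :
    postLap T ∈ elemSpan (A + 2) (β + 2) K := by
  have h : elemSpan A β K ≤ (elemSpan (A + 2) (β + 2) K).comap postLap := by
    refine Submodule.span_le.2 ?_
    rintro _ ⟨a, b, ha, hb, rfl⟩
    rw [SetLike.mem_coe, Submodule.mem_comap, postLap_elem]
    refine Submodule.sum_mem _ fun i _ => Submodule.add_mem _ (Submodule.add_mem _ ?_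
      (Submodule.smul_mem _ _ ?_)) ?_ <;>
    refine elem_mem_elemSpan K ?_ ?_ <;> (try simp only [List.length_cons]) <;> omega
  exact h hT

/-- The same operators written with one more inverse Laplacian and two more derivatives, so that
errors of different stages lie in a common span. -/
theorem elemSpan_le_raise (A β K : ℕ) : elemSpan A β K ≤ elemSpan A (β + 2) (K + 1) := by
  refine Submodule.span_le.2 ?_
  rintro _ ⟨a, b, ha, hb, rfl⟩
  rw [SetLike.mem_coe, ← sum_elem_cons_cons]
  exact Submodule.sum_mem _ fun i _ => elem_mem_elemSpan _ ha (by simp; omega)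

theorem elemSpan_le_raise_add (A β K j : ℕ) :
    elemSpan A β K ≤ elemSpan A (β + 2 * j) (K + j) := by
  induction j with
  | zero => exact le_rfl
  | succ j ih => exact ih.trans (elemSpan_le_raise _ _ _)

/-- Applying `Δ^j` to `∂^a f · ∂^b Δ^{-K-j} g` recovers `∂^a f · ∂^b Δ^{-K} g` up to terms in which
at least one further derivative falls on `f`. -/
theorem exists_postLap_pow_elem (j : ℕ) (a b : List (Fin 2)) (K : ℕ) :
    ∃ W ∈ elemSpan (a.length + 2 * j) (b.length + 2 * j) (K + j),
      (postLap ^ j) (elem a b (K + j)) = elem a b K + W := by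
  induction j generalizing K with
  | zero => exact ⟨0, Submodule.zero_mem _, by simp⟩
  | succ j ih =>
    obtain ⟨W, hW, e⟩ := ih (K + 1)
    have h1 := postLap_mem_elemSpan hW
    have h2 : ∑ i, (2 : ℝ) • elem (i :: a) (i :: b) (K + 1) +
        ∑ i, elem (i :: i :: a) b (K + 1) ∈ elemSpan (a.length + 2) (b.length + 2) (K + 1) := by
      refine Submodule.add_mem _ (Submodule.sum_mem _ fun i _ => Submodule.smul_mem _ _ ?_)
        (Submodule.sum_mem _ fun i _ => ?_) <;>
      refine elem_mem_elemSpan _ ?_ ?_ <;> simp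
    have h3 := elemSpan_le_raise_add _ _ _ j h2
    have e2 : K + (j + 1) = K + 1 + j := by ring
    rw [e2]
    refine ⟨_, Submodule.add_mem _ (elemSpan_mono ?_ ?_ _ h3) (elemSpan_mono ?_ ?_ _ h1), ?_⟩
    any_goals omega
    rw [pow_succ', Module.End.mul_apply, e, map_add, postLap_elem, Finset.sum_add_distrib,
      Finset.sum_add_distrib, sum_elem_cons_cons]
    simp only [add_assoc]

/-- Approximate inversion of `Δ^N` on the span of elementary operators, with an error of lower
order in the periodic function. -/
theorem exists_approx_inverse {A β K : ℕ} (N : ℕ) {T : BilinOp} (hT : T ∈ elemSpan A β K) :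
    ∃ S ∈ elemSpan A β (K + N), ∃ W ∈ elemSpan (A + 2 * N) (β + 2 * N - 1) (K + N),
      (postLap ^ N) S = T + W := by
  induction hT using Submodule.span_induction with
  | mem T h =>
    obtain ⟨a, b, ha, hb, rfl⟩ := h
    obtain ⟨W, hW, e⟩ := exists_postLap_pow_elem N a b K
    refine ⟨elem a b (K + N), elem_mem_elemSpan _ ha hb, W, elemSpan_mono ?_ ?_ _ hW, e⟩ <;> omega
  | zero => exact ⟨0, Submodule.zero_mem _, 0, Submodule.zero_mem _, by simp⟩
  | add T₁ T₂ _ _ h₁ h₂ =>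
    obtain ⟨S₁, hS₁, W₁, hW₁, e₁⟩ := h₁
    obtain ⟨S₂, hS₂, W₂, hW₂, e₂⟩ := h₂
    refine ⟨S₁ + S₂, Submodule.add_mem _ hS₁ hS₂, W₁ + W₂, Submodule.add_mem _ hW₁ hW₂, ?_⟩
    rw [map_add, e₁, e₂, add_add_add_comm]
  | smul c T _ h =>
    obtain ⟨S, hS, W, hW, e⟩ := h
    refine ⟨c • S, Submodule.smul_mem _ _ hS, c • W, Submodule.smul_mem _ _ hW, ?_⟩
    rw [map_smul, e, smul_add]

/-- The span of the elementary operators `∂^a f · ∂^b Δ^{-k} (Δ^{-N} g)` with `|a| ≤ A` and with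
`∂^b Δ^{-k}` of negative order or the identity. -/
noncomputable def mainSpan (N A : ℕ) : Submodule ℝ BilinOp :=
  Submodule.span ℝ {T | ∃ a b k, a.length ≤ A ∧ (b.length < 2 * k ∨ b = [] ∧ k = 0) ∧
    T = elem a b (k + N)}

theorem mainSpan_mono {N A A' : ℕ} (hA : A ≤ A') : mainSpan N A ≤ mainSpan N A' :=
  Submodule.span_mono fun _ ⟨a, b, k, ha, hb, h⟩ => ⟨a, b, k, ha.trans hA, hb, h⟩

theorem elemSpan_le_mainSpan {N A β k : ℕ} (h : β ≤ 2 * k) :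
    elemSpan A β (k + N) ≤ mainSpan N A :=
  Submodule.span_mono fun _ ⟨a, b, ha, hb, e⟩ => ⟨a, b, k, ha, Or.inl (hb.trans_le h), e⟩

/-- Construction of the improved inverse of `Δ^N`: each of the `M` corrections lowers
the order of the error in the periodic function by one. -/
theorem exists_bilinear_operators (N M : ℕ) :
    ∃ B ∈ mainSpan N (2 * N * M),
      ∃ V ∈ elemSpan (2 * N * (M + 1)) (2 * N * (M + 1) - M) (N * (M + 1)),
        (postLap ^ N) B = mulTP + V := by
  induction M with
  | zero =>
    obtain ⟨W, hW, e⟩ := exists_postLap_pow_elem N [] [] 0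
    refine ⟨elem [] [] (0 + N), Submodule.subset_span ⟨[], [], 0, by simp, by simp, rfl⟩, W, ?_, e⟩
    simpa using hW
  | succ M ih =>
    obtain ⟨B, hB, V, hV, e⟩ := ih
    obtain ⟨S, hS, W, hW, e'⟩ := exists_approx_inverse N hV
    have e1 : N * (M + 1 + 1) = N * (M + 1) + N := by ring
    have e2 : 2 * N * (M + 1 + 1) = 2 * N * (M + 1) + 2 * N := by ring
    have e3 : 2 * N * (M + 1) - M + 2 * N - 1 ≤ 2 * N * (M + 1) + 2 * N - (M + 1) := by
      rcases Nat.eq_zero_or_pos N with rfl | hN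
      · simp
      · have : M ≤ 2 * N * (M + 1) := by nlinarith
        omega
    have hβ : 2 * N * (M + 1) - M ≤ 2 * (N * (M + 1)) := by rw [← mul_assoc]; omega
    refine ⟨B + (-1 : ℝ) • S, Submodule.add_mem _ (mainSpan_mono ?_ hB)
      (Submodule.smul_mem _ _ (elemSpan_le_mainSpan hβ hS)), (-1 : ℝ) • W,
      Submodule.smul_mem _ _ ?_, ?_⟩
    · gcongr; omega
    · rw [e1, e2]
      exact elemSpan_mono le_rfl e3 _ hW
    · rw [map_add, map_smul, e, e']
      module

/-! ### Time derivatives -/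

section time

open Filter Topology

theorem interior_interval_nonempty {I : Set ℝ} (hI : I.OrdConnected) (hn : I.Nontrivial) :
    (interior I).Nonempty := by
  obtain ⟨a, ha, b, hb, hab⟩ := hn.exists_lt
  exact ⟨(a + b) / 2, mem_interior.2 ⟨Set.Ioo a b, Set.Ioo_subset_Icc_self.trans (hI.out ha hb),
    isOpen_Ioo, ⟨by linarith, by linarith⟩⟩⟩

theorem uniqueDiffOn_interval {I : Set ℝ} (hI : I.OrdConnected) (hn : I.Nontrivial) :
    UniqueDiffOn ℝ I :=
  uniqueDiffOn_convex hI.convex (interior_interval_nonempty hI hn)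

theorem mem_closure_interior_interval {I : Set ℝ} (hI : I.OrdConnected) (hn : I.Nontrivial)
    {t : ℝ} (ht : t ∈ I) (x : Plane) :
    (t, x) ∈ closure (interior (I ×ˢ (Set.univ : Set Plane))) := by
  rw [interior_prod_eq, interior_univ, closure_prod_eq, closure_univ,
    (hI.convex : Convex ℝ I).closure_interior_eq_closure_of_nonempty_interior
      (interior_interval_nonempty hI hn)]
  exact ⟨subset_closure ht, Set.mem_univ _⟩

section slices

variable {I : Set ℝ} {U : ℝ × Plane → ℝ} {t : ℝ}

/-- The spatial derivative as a derivative within space-time. -/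
theorem fderivWithin_space (hU : ContDiffOn ℝ ∞ U (I ×ˢ Set.univ)) (ht : t ∈ I) (x v : Plane) :
    fderiv ℝ (fun y => U (t, y)) x v = fderivWithin ℝ U (I ×ˢ Set.univ) (t, x) (0, v) := by
  have h1 := ((hU.differentiableOn (by simp)) (t, x) ⟨ht, Set.mem_univ _⟩).hasFDerivWithinAt
  have h2 : HasFDerivWithinAt (fun y : Plane => ((t, y) : ℝ × Plane))
      (ContinuousLinearMap.inr ℝ ℝ Plane) Set.univ x :=
    (hasFDerivAt_prodMk_right t x).hasFDerivWithinAt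
  have h3 := h1.comp x h2 fun y _ => ⟨ht, Set.mem_univ _⟩
  rw [hasFDerivWithinAt_univ] at h3
  have h4 : fderiv ℝ (fun y => U (t, y)) x = _ := h3.fderiv
  rw [h4]
  simp

theorem hasDerivWithinAt_time (hU : ContDiffOn ℝ ∞ U (I ×ˢ Set.univ)) (ht : t ∈ I) (x : Plane) :
    HasDerivWithinAt (fun τ => U (τ, x)) (fderivWithin ℝ U (I ×ˢ Set.univ) (t, x) (1, 0)) I t := by
  have h1 := ((hU.differentiableOn (by simp)) (t, x) ⟨ht, Set.mem_univ _⟩).hasFDerivWithinAt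
  have h2 : HasDerivWithinAt (fun τ : ℝ => ((τ, x) : ℝ × Plane)) (1, 0) I t :=
    (hasDerivWithinAt_id t I).prodMk (hasDerivWithinAt_const t I x)
  exact h1.comp_hasDerivWithinAt t h2 fun τ hτ => Set.mk_mem_prod hτ (Set.mem_univ x)

end slices

/-- Time and space derivatives commute up to the boundary of the time interval. -/
theorem hasDerivWithinAt_pd {I : Set ℝ} (hI : I.OrdConnected) (hn : I.Nontrivial)
    {u u' : ℝ → Plane → ℝ} (hU : ContDiffOn ℝ ∞ (fun p : ℝ × Plane => u p.1 p.2) (I ×ˢ Set.univ))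
    (hu : ∀ t ∈ I, ∀ x, HasDerivWithinAt (fun τ => u τ x) (u' t x) I t) (i : Fin 2) :
    ContDiffOn ℝ ∞ (fun p : ℝ × Plane => pd i (u p.1) p.2) (I ×ˢ Set.univ) ∧
      ∀ t ∈ I, ∀ x, HasDerivWithinAt (fun τ => pd i (u τ) x) (pd i (u' t) x) I t := by
  set U : ℝ × Plane → ℝ := fun p => u p.1 p.2
  set S : Set (ℝ × Plane) := I ×ˢ Set.univ
  have hS : UniqueDiffOn ℝ S := (uniqueDiffOn_interval hI hn).prod uniqueDiffOn_univ
  have hD : ContDiffOn ℝ ∞ (fderivWithin ℝ U S) S := hU.fderivWithin hS (by simp)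
  have hpd : ∀ p ∈ S, pd i (u p.1) p.2 = fderivWithin ℝ U S p (0, basisVec i) := fun p hp =>
    fderivWithin_space hU hp.1 p.2 _
  have hV : ContDiffOn ℝ ∞ (fun p : ℝ × Plane => pd i (u p.1) p.2) S :=
    (hD.clm_apply contDiffOn_const).congr hpd
  refine ⟨hV, fun t ht x => ?_⟩
  have hp : ((t, x) : ℝ × Plane) ∈ S := ⟨ht, Set.mem_univ _⟩
  have hu' : ∀ p ∈ S, u' p.1 p.2 = fderivWithin ℝ U S p (1, 0) := fun p hp =>
    ((uniqueDiffOn_interval hI hn) p.1 hp.1).eq_deriv _ (hu p.1 hp.1 p.2)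
      (hasDerivWithinAt_time hU hp.1 p.2)
  have hU' : ContDiffOn ℝ ∞ (fun p : ℝ × Plane => u' p.1 p.2) S :=
    (hD.clm_apply contDiffOn_const).congr hu'
  have hDd : DifferentiableWithinAt ℝ (fderivWithin ℝ U S) S (t, x) :=
    (hD.differentiableOn (by simp)) _ hp
  have hsecond (v w : ℝ × Plane) : fderivWithin ℝ (fun p => fderivWithin ℝ U S p v) S (t, x) w =
      fderivWithin ℝ (fderivWithin ℝ U S) S (t, x) w v := by
    rw [fderivWithin_clm_apply (hS _ hp) hDd (differentiableWithinAt_const _)]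
    simp
  have hsymm : IsSymmSndFDerivWithinAt ℝ U S (t, x) :=
    (hU _ hp).isSymmSndFDerivWithinAt
      (by rw [minSmoothness_of_isRCLikeNormedField]; exact ENat.LEInfty.out) hS
      (mem_closure_interior_interval hI hn ht x) hp
  have h1 := hasDerivWithinAt_time hV ht x
  have h2 : fderivWithin ℝ (fun p : ℝ × Plane => pd i (u p.1) p.2) S (t, x) (1, 0) =
      pd i (u' t) x := by
    have h3 : pd i (u' t) x =
        fderivWithin ℝ (fun p : ℝ × Plane => u' p.1 p.2) S (t, x) (0, basisVec i) :=
      fderivWithin_space hU' ht x _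
    rw [h3, fderivWithin_congr hpd (hpd _ hp), fderivWithin_congr hu' (hu' _ hp), hsecond, hsecond]
    exact hsymm _ _
  rw [← h2]
  exact h1

theorem hasDerivWithinAt_pds {I : Set ℝ} (hI : I.OrdConnected) (hn : I.Nontrivial)
    {u u' : ℝ → Plane → ℝ} (hU : ContDiffOn ℝ ∞ (fun p : ℝ × Plane => u p.1 p.2) (I ×ˢ Set.univ))
    (hu : ∀ t ∈ I, ∀ x, HasDerivWithinAt (fun τ => u τ x) (u' t x) I t) (w : List (Fin 2)) :
    ContDiffOn ℝ ∞ (fun p : ℝ × Plane => pds w (u p.1) p.2) (I ×ˢ Set.univ) ∧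
      ∀ t ∈ I, ∀ x, HasDerivWithinAt (fun τ => pds w (u τ) x) (pds w (u' t) x) I t := by
  induction w with
  | nil => exact ⟨hU, hu⟩
  | cons i w ih => exact hasDerivWithinAt_pd hI hn ih.1 ih.2 i

/-- The difference quotients in time of a smooth family of periodic functions converge uniformly in
space. -/
theorem eventually_forall_abs_sub_le {I : Set ℝ} (hI : I.OrdConnected) (hn : I.Nontrivial)
    {g g' : ℝ → PeriodicMeanZero}
    (hg : ContDiffOn ℝ ∞ (fun p : ℝ × Plane => (g p.1 : Plane → ℝ) p.2) (I ×ˢ Set.univ))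
    (hg' : ∀ t ∈ I, ∀ x : Plane,
      HasDerivWithinAt (fun τ => (g τ : Plane → ℝ) x) ((g' t : Plane → ℝ) x) I t)
    {t : ℝ} (ht : t ∈ I) {ε : ℝ} (hε : 0 < ε) :
    ∀ᶠ τ in 𝓝[I] t, ∀ x : Plane,
      |(g τ : Plane → ℝ) x - (g t : Plane → ℝ) x - (τ - t) * (g' t : Plane → ℝ) x| ≤
        ε * |τ - t| := by
  set U : ℝ × Plane → ℝ := fun p => (g p.1 : Plane → ℝ) p.2
  set S : Set (ℝ × Plane) := I ×ˢ Set.univ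
  have hS : UniqueDiffOn ℝ S := (uniqueDiffOn_interval hI hn).prod uniqueDiffOn_univ
  have hD : ContDiffOn ℝ ∞ (fderivWithin ℝ U S) S := hg.fderivWithin hS (by simp)
  have hcont : ContinuousOn (fun p : ℝ × Plane => (g' p.1 : Plane → ℝ) p.2) S :=
    ((hD.clm_apply contDiffOn_const).congr fun p hp =>
      ((uniqueDiffOn_interval hI hn) p.1 hp.1).eq_deriv _ (hg' p.1 hp.1 p.2)
        (hasDerivWithinAt_time hg hp.1 p.2)).continuousOn
  -- uniform continuity in time over the compact cell
  have hunif : ∀ᶠ σ in 𝓝 t, ∀ y ∈ unitCell,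
      σ ∈ I → |(g' σ : Plane → ℝ) y - (g' t : Plane → ℝ) y| ≤ ε := by
    refine isCompact_unitCell.eventually_forall_of_forall_eventually fun y _ => ?_
    have h1 := Metric.tendsto_nhds.1 (hcont (t, y) ⟨ht, Set.mem_univ _⟩) (ε / 2) (by positivity)
    have h2 := Metric.tendsto_nhds.1 ((contDiff_coe (g' t)).continuous.tendsto y) (ε / 2)
      (by positivity)
    rw [eventually_nhdsWithin_iff] at h1
    have h3 : ∀ᶠ z : ℝ × Plane in 𝓝 (t, y),
        dist ((g' t : Plane → ℝ) z.2) ((g' t : Plane → ℝ) y) < ε / 2 :=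
      (continuous_snd.tendsto ((t, y) : ℝ × Plane)).eventually h2
    filter_upwards [h1, h3] with z hz1 hz2 hzI
    have hz3 := hz1 ⟨hzI, Set.mem_univ _⟩
    have := dist_triangle_right ((g' z.1 : Plane → ℝ) z.2) ((g' t : Plane → ℝ) z.2)
      ((g' t : Plane → ℝ) y)
    rw [← Real.dist_eq]
    linarith
  obtain ⟨δ, hδ, hball⟩ := Metric.eventually_nhds_iff_ball.1 hunif
  have hmem : I ∩ Metric.ball t δ ∈ 𝓝[I] t :=
    inter_mem_nhdsWithin I (Metric.ball_mem_nhds t hδ)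
  filter_upwards [hmem] with τ hτ
  have hcell : ∀ y ∈ unitCell,
      |(g τ : Plane → ℝ) y - (g t : Plane → ℝ) y - (τ - t) * (g' t : Plane → ℝ) y| ≤
        ε * |τ - t| := by
    intro y hy
    have hconv : Convex ℝ (I ∩ Metric.ball t δ) := hI.convex.inter (convex_ball t δ)
    have hder : ∀ σ ∈ I ∩ Metric.ball t δ,
        HasDerivWithinAt (fun σ => (g σ : Plane → ℝ) y - σ * (g' t : Plane → ℝ) y)
          ((g' σ : Plane → ℝ) y - (g' t : Plane → ℝ) y) (I ∩ Metric.ball t δ) σ := by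
      intro σ hσ
      have h1 := (hg' σ hσ.1 y).mono (Set.inter_subset_left (t := Metric.ball t δ))
      have h2 := (hasDerivWithinAt_id σ (I ∩ Metric.ball t δ)).mul_const ((g' t : Plane → ℝ) y)
      rw [one_mul] at h2
      exact h1.sub h2
    have := hconv.norm_image_sub_le_of_norm_hasDerivWithin_le (C := ε) hder
      (fun σ hσ => hball σ hσ.2 y hy hσ.1) ⟨ht, Metric.mem_ball_self hδ⟩ hτ
    rw [Real.norm_eq_abs, Real.norm_eq_abs] at this
    refine le_trans (le_of_eq ?_) this
    congr 1
    ring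
  intro x
  set y : Plane := x + WithLp.toLp 2 fun i => ((-⌊x i⌋ : ℤ) : ℝ)
  have hy : y ∈ unitCell := fun i => by
    simp only [y, PiLp.add_apply, Int.cast_neg]
    exact ⟨by linarith [Int.floor_le (x i)], by linarith [Int.lt_floor_add_one (x i)]⟩
  have hper (h : PeriodicMeanZero) : (h : Plane → ℝ) y = (h : Plane → ℝ) x :=
    (periodic_coe h).add_lattice x _
  have := hcell y hy
  rwa [hper, hper, hper] at this

/-- Operators `∂^b Δ^{-k}` of negative order, being bounded for the supremum norm, commute with the
time derivative; so does the identity. -/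
theorem hasDerivWithinAt_pdsP_invPow {I : Set ℝ} (hI : I.OrdConnected) (hn : I.Nontrivial)
    {g g' : ℝ → PeriodicMeanZero}
    (hg : ContDiffOn ℝ ∞ (fun p : ℝ × Plane => (g p.1 : Plane → ℝ) p.2) (I ×ˢ Set.univ))
    (hg' : ∀ t ∈ I, ∀ x : Plane,
      HasDerivWithinAt (fun τ => (g τ : Plane → ℝ) x) ((g' t : Plane → ℝ) x) I t)
    {b : List (Fin 2)} {k : ℕ} (hb : b.length < 2 * k ∨ b = [] ∧ k = 0) {t : ℝ} (ht : t ∈ I)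
    (x : Plane) :
    HasDerivWithinAt (fun τ => (pdsP b (invPow k (g τ)) : Plane → ℝ) x)
      ((pdsP b (invPow k (g' t)) : Plane → ℝ) x) I t := by
  rcases hb with hb | ⟨rfl, rfl⟩
  · obtain ⟨C, -, hC⟩ := exists_eLpNorm_pdsP_invPow_le hb
    rw [hasDerivWithinAt_iff_isLittleO, Asymptotics.isLittleO_iff]
    intro c hc
    have hε : 0 < c / (C + 1) := by positivity
    filter_upwards [eventually_forall_abs_sub_le hI hn hg hg' ht hε] with τ hτ
    set h : PeriodicMeanZero := g τ + (-1 : ℝ) • g t + (-(τ - t)) • g' t with hh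
    have h1 : ∀ y, |(h : Plane → ℝ) y| ≤ c / (C + 1) * |τ - t| := fun y => by
      have e : (h : Plane → ℝ) y =
          (g τ : Plane → ℝ) y - (g t : Plane → ℝ) y - (τ - t) * (g' t : Plane → ℝ) y := by
        simp [hh]; ring
      rw [e]; exact hτ y
    have h2 := hC h _ h1 x
    have h3 : (pdsP b (invPow k h) : Plane → ℝ) x = (pdsP b (invPow k (g τ)) : Plane → ℝ) x -
        (pdsP b (invPow k (g t)) : Plane → ℝ) x -
          (τ - t) • (pdsP b (invPow k (g' t)) : Plane → ℝ) x := by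
      simp only [hh, map_add, map_smul, Submodule.coe_add, Submodule.coe_smul, Pi.add_apply,
        Pi.smul_apply, smul_eq_mul]
      ring
    rw [← h3, Real.norm_eq_abs, Real.norm_eq_abs]
    refine h2.trans ?_
    rw [← mul_assoc]
    refine mul_le_mul_of_nonneg_right ?_ (abs_nonneg _)
    rw [mul_div_assoc', div_le_iff₀ (by positivity)]
    nlinarith [C.coe_nonneg]
  · exact hg' t ht x

/-- The Leibniz rule in time for a bilinear operator. -/
def TimeLeibniz (T : BilinOp) : Prop :=
  ∀ I : Set ℝ, I.OrdConnected → I.Nontrivial →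
    ∀ (f f' : ℝ → TestFun) (g g' : ℝ → PeriodicMeanZero),
    ContDiffOn ℝ ∞ (fun p : ℝ × Plane => (f p.1 : Plane → ℝ) p.2) (I ×ˢ Set.univ) →
    ContDiffOn ℝ ∞ (fun p : ℝ × Plane => (g p.1 : Plane → ℝ) p.2) (I ×ˢ Set.univ) →
    (∀ t ∈ I, ∀ x : Plane,
      HasDerivWithinAt (fun τ => (f τ : Plane → ℝ) x) ((f' t : Plane → ℝ) x) I t) →
    (∀ t ∈ I, ∀ x : Plane,
      HasDerivWithinAt (fun τ => (g τ : Plane → ℝ) x) ((g' t : Plane → ℝ) x) I t) →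
    ∀ t ∈ I, ∀ x : Plane,
      HasDerivWithinAt (fun τ => (T (f τ) (g τ) : Plane → ℝ) x)
        ((T (f' t) (g t) : Plane → ℝ) x + (T (f t) (g' t) : Plane → ℝ) x) I t

theorem timeLeibniz_elem {a b : List (Fin 2)} {k : ℕ}
    (hb : b.length < 2 * k ∨ b = [] ∧ k = 0) : TimeLeibniz (elem a b k) := by
  intro I hI hn f f' g g' hf hg hf' hg' t ht x
  have h1 := (hasDerivWithinAt_pds hI hn hf hf' a).2 t ht x
  have h2 := hasDerivWithinAt_pdsP_invPow hI hn hg hg' hb ht x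
  simp only [coe_elem, Pi.mul_apply]
  exact h1.mul h2

theorem timeLeibniz_of_mem_span {G : Set BilinOp} (hG : ∀ T ∈ G, TimeLeibniz T) {T : BilinOp}
    (hT : T ∈ Submodule.span ℝ G) : TimeLeibniz T := by
  induction hT using Submodule.span_induction with
  | mem T h => exact hG T h
  | zero =>
    intro I hI hn f f' g g' hf hg hf' hg' t ht x
    simpa using hasDerivWithinAt_const t I (0 : ℝ)
  | add T₁ T₂ _ _ h₁ h₂ =>
    intro I hI hn f f' g g' hf hg hf' hg' t ht x
    have := (h₁ I hI hn f f' g g' hf hg hf' hg' t ht x).add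
      (h₂ I hI hn f f' g g' hf hg hf' hg' t ht x)
    rw [add_add_add_comm] at this
    exact this
  | smul c T _ h =>
    intro I hI hn f f' g g' hf hg hf' hg' t ht x
    have := (h I hI hn f f' g g' hf hg hf' hg' t ht x).const_mul c
    rw [mul_add] at this
    exact this

end time

/-! ### Supports and Sobolev bounds -/

section bounds

open MeasureTheory

theorem tsupport_subset_of_mem_span {G : Set BilinOp} {f : TestFun} {g : PeriodicMeanZero}
    (hG : ∀ T ∈ G, tsupport (T f g : Plane → ℝ) ⊆ tsupport (f : Plane → ℝ)) {T : BilinOp}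
    (hT : T ∈ Submodule.span ℝ G) : tsupport (T f g : Plane → ℝ) ⊆ tsupport (f : Plane → ℝ) := by
  induction hT using Submodule.span_induction with
  | mem T h => exact hG T h
  | zero => simp
  | add T₁ T₂ _ _ h₁ h₂ => exact (tsupport_add _ _).trans (Set.union_subset h₁ h₂)
  | smul c T _ h => exact (tsupport_smul_subset_right (fun _ => c) _).trans h

theorem tsupport_elem_subset (a b : List (Fin 2)) (k : ℕ) (f : TestFun) (g : PeriodicMeanZero) :
    tsupport (elem a b k f g : Plane → ℝ) ⊆ tsupport (f : Plane → ℝ) := by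
  rw [coe_elem]
  exact tsupport_mul_subset_left.trans (tsupport_pds_subset _ a)

theorem sobolevNormPlane_add_le (m : ℕ) {s : ℝ≥0∞} (hs : 1 ≤ s) {u v : Plane → ℝ}
    (hu : ContDiff ℝ ∞ u) (hv : ContDiff ℝ ∞ v) :
    sobolevNormPlane m s (u + v) ≤ sobolevNormPlane m s u + sobolevNormPlane m s v := by
  unfold sobolevNormPlane sobolevNorm
  rw [← Finset.sum_add_distrib]
  refine Finset.sum_le_sum fun j _ => ?_
  have e : (fun x => iteratedFDeriv ℝ j (u + v) x) =
      (fun x => iteratedFDeriv ℝ j u x) + fun x => iteratedFDeriv ℝ j v x := by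
    funext x
    exact iteratedFDeriv_add_apply ((hu.of_le (by exact_mod_cast le_top)).contDiffAt)
      ((hv.of_le (by exact_mod_cast le_top)).contDiffAt)
  rw [e]
  exact eLpNorm_add_le (hu.continuous_iteratedFDeriv_of_infty j).aestronglyMeasurable
    (hv.continuous_iteratedFDeriv_of_infty j).aestronglyMeasurable hs

theorem sobolevNormPlane_smul (m : ℕ) (s : ℝ≥0∞) (c : ℝ) {u : Plane → ℝ}
    (hu : ContDiff ℝ ∞ u) : sobolevNormPlane m s (c • u) = ‖c‖ₑ * sobolevNormPlane m s u := by
  unfold sobolevNormPlane sobolevNorm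
  rw [Finset.mul_sum]
  exact Finset.sum_congr rfl fun j _ => eLpNorm_iteratedFDeriv_smul hu c j s _

/-- The bound of `‖T(f, g)‖_{W^{m,s}(ℝ²)}` by a multiple of `‖f‖_{C^k} · X_s(g)`, the multiple
depending on the size of the support of `f`. -/
def SobolevBound (m k : ℕ) (X : ℝ≥0∞ → PeriodicMeanZero → ℝ≥0∞) (T : BilinOp) : Prop :=
  ∃ C : ℝ≥0, ∀ s : ℝ≥0∞, 1 ≤ s → ∀ (f : TestFun) (x₀ : Plane) (R : ℝ), 0 ≤ R →
    tsupport (f : Plane → ℝ) ⊆ Metric.closedBall x₀ R → ∀ g : PeriodicMeanZero,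
      sobolevNormPlane m s (T f g : Plane → ℝ) ≤
        C * ENNReal.ofReal (1 + R) ^ (2 / s).toReal * cNorm k (f : Plane → ℝ) * X s g

theorem sobolevBound_of_mem_span {m k : ℕ} {X : ℝ≥0∞ → PeriodicMeanZero → ℝ≥0∞} {G : Set BilinOp}
    (hG : ∀ T ∈ G, SobolevBound m k X T) {T : BilinOp} (hT : T ∈ Submodule.span ℝ G) :
    SobolevBound m k X T := by
  induction hT using Submodule.span_induction with
  | mem T h => exact hG T h
  | zero =>
    refine ⟨0, fun s _ f x₀ R _ _ g => le_of_eq_of_le ?_ zero_le⟩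
    have := sobolevNormPlane_smul m s 0 (u := 0) contDiff_const
    simpa using this
  | add T₁ T₂ _ _ h₁ h₂ =>
    obtain ⟨C₁, h₁⟩ := h₁
    obtain ⟨C₂, h₂⟩ := h₂
    refine ⟨C₁ + C₂, fun s hs f x₀ R hR hf g => ?_⟩
    refine (sobolevNormPlane_add_le m hs (contDiff_coe_testFun (T₁ f g))
      (contDiff_coe_testFun (T₂ f g))).trans ?_
    push_cast
    simp only [add_mul]
    exact add_le_add (h₁ s hs f x₀ R hR hf g) (h₂ s hs f x₀ R hR hf g)
  | smul c T _ h =>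
    obtain ⟨C, h⟩ := h
    refine ⟨‖c‖₊ * C, fun s hs f x₀ R hR hf g => ?_⟩
    refine (sobolevNormPlane_smul m s c (contDiff_coe_testFun (T f g))).trans_le ?_
    push_cast
    simp only [mul_assoc]
    have := h s hs f x₀ R hR hf g
    simp only [mul_assoc] at this
    exact mul_le_mul_right this _

/-- An elementary operator inherits the bound of its factor acting on the periodic function. -/
theorem sobolevBound_elem {m A : ℕ} {X : ℝ≥0∞ → PeriodicMeanZero → ℝ≥0∞} {a b : List (Fin 2)}
    {k : ℕ} (ha : a.length ≤ A)
    (h : ∃ C : ℝ≥0, ∀ s : ℝ≥0∞, 1 ≤ s → ∀ g : PeriodicMeanZero,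
      sobolevNormTorus m s (pdsP b (invPow k g) : Plane → ℝ) ≤ C * X s g) :
    SobolevBound m (A + m) X (elem a b k) := by
  obtain ⟨C, hC⟩ := h
  refine ⟨((m + 1) * 2 ^ m * 9 : ℕ) * C, fun s hs f x₀ R hR hf g => ?_⟩
  rw [coe_elem]
  refine (sobolevNormPlane_mul_le m ha hs (contDiff_coe_testFun f) hR hf (periodic_coe _)
    (contDiff_coe _)).trans ((mul_le_mul_right (hC s hs g) _).trans_eq ?_)
  push_cast
  ring

theorem sobolevBound_of_mem_mainSpan {N A : ℕ} {T : BilinOp} (hT : T ∈ mainSpan N A) (m : ℕ) :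
    SobolevBound m (A + m) (fun s g => sobolevNormTorus m s (invPow N g : Plane → ℝ)) T := by
  refine sobolevBound_of_mem_span ?_ hT
  rintro _ ⟨a, b, k, ha, hb, rfl⟩
  obtain ⟨C, hC⟩ := exists_sobolevNormTorus_le hb m
  exact sobolevBound_elem ha ⟨C, fun s hs g => by rw [invPow_add]; exact hC s hs _⟩

theorem sobolevBound_of_mem_elemSpan {A β L j : ℕ} {T : BilinOp} (hT : T ∈ elemSpan A β (L + j))
    (hβ : β ≤ 2 * L) (m : ℕ) :
    SobolevBound m (A + m) (fun s g => sobolevNormTorus m s (invPow j g : Plane → ℝ)) T := by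
  refine sobolevBound_of_mem_span ?_ hT
  rintro _ ⟨a, b, ha, hb, rfl⟩
  obtain ⟨C, hC⟩ := exists_sobolevNormTorus_le (Or.inl (hb.trans_le hβ)) m
  exact sobolevBound_elem ha ⟨C, fun s hs g => by rw [invPow_add]; exact hC s hs _⟩

theorem sobolevBound_succ_of_mem_elemSpan {A β L j : ℕ} {T : BilinOp}
    (hT : T ∈ elemSpan A β (L + j)) (hβ : β ≤ 2 * L + 1) (m : ℕ) :
    SobolevBound m (A + m) (fun s g => sobolevNormTorus (m + 1) s (invPow j g : Plane → ℝ)) T := by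
  refine sobolevBound_of_mem_span ?_ hT
  rintro _ ⟨a, b, ha, hb, rfl⟩
  obtain ⟨C, hC⟩ := exists_sobolevNormTorus_le_succ (w := b) (L := L) (by omega) m
  exact sobolevBound_elem ha ⟨C, fun s hs g => by rw [invPow_add]; exact hC s hs _⟩

/-- The norm of the periodic function in the bound of the error: it measures `g` in a Sobolev space
of order `-M`, relative to `W^{m,s}(𝕋²)`. -/
noncomputable def errorNorm (M m : ℕ) (s : ℝ≥0∞) (g : PeriodicMeanZero) : ℝ≥0∞ :=
  if Even M then sobolevNormTorus m s (invLap (M / 2) (g : Plane → ℝ))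
    else sobolevNormTorus (m + 1) s (invLap ((M + 1) / 2) (g : Plane → ℝ))

theorem sobolevBound_error {N M : ℕ} {V : BilinOp}
    (hV : V ∈ elemSpan (2 * N * (M + 1)) (2 * N * (M + 1) - M) (N * (M + 1))) (m : ℕ) :
    SobolevBound m (2 * N * (M + 1) + m) (errorNorm M m) V := by
  rcases Nat.eq_zero_or_pos N with rfl | hN
  · -- the span is trivial
    refine sobolevBound_of_mem_span ?_ hV
    rintro _ ⟨a, b, -, hb, -⟩
    simp at hb
  have hMN : M + 1 ≤ N * (M + 1) := Nat.le_mul_of_pos_left _ hN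
  have e : 2 * N * (M + 1) = 2 * (N * (M + 1)) := mul_assoc _ _ _
  rcases Nat.even_or_odd M with hM | hM
  · have e1 : N * (M + 1) = (N * (M + 1) - M / 2) + M / 2 := by omega
    rw [e1] at hV
    have := sobolevBound_of_mem_elemSpan hV (by rw [e]; obtain ⟨r, rfl⟩ := hM; omega) m
    simpa only [SobolevBound, errorNorm, if_pos hM, coe_invPow] using this
  · have e1 : N * (M + 1) = (N * (M + 1) - (M + 1) / 2) + (M + 1) / 2 := by omega
    rw [e1] at hV
    have := sobolevBound_succ_of_mem_elemSpan hV (by rw [e]; obtain ⟨r, rfl⟩ := hM; omega) m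
    simpa only [SobolevBound, errorNorm, if_neg (Nat.not_even_iff_odd.2 hM), coe_invPow] using this

theorem exists_errorNorm_osc_le (M m : ℕ) :
    ∃ C : ℝ≥0, ∀ s : ℝ≥0∞, 1 ≤ s → ∀ (lam : ℕ) (hl : 1 ≤ lam) (g : PeriodicMeanZero),
      errorNorm M m s (osc lam hl g) ≤ C * (lam : ℝ≥0∞) ^ (-(M : ℤ) + (m : ℤ)) *
        sobolevNormTorus m s (g : Plane → ℝ) := by
  rcases Nat.even_or_odd M with hM | hM
  · obtain ⟨C₁, h₁⟩ := exists_sobolevNormTorus_invPow_osc_le m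
    obtain ⟨C₂, h₂⟩ := exists_sobolevNormTorus_le (w := []) (L := M / 2) (by simp; omega) m
    refine ⟨C₁ * C₂, fun s hs lam hl g => ?_⟩
    simp only [errorNorm, if_pos hM, ← coe_invPow]
    refine (h₁ _ s hs lam hl g).trans ((mul_le_mul_right (h₂ s hs g) _).trans_eq ?_)
    have e : -(2 * (M / 2 : ℕ) : ℤ) = -(M : ℤ) := by obtain ⟨r, rfl⟩ := hM; omega
    rw [e]
    push_cast
    ring
  · obtain ⟨C₁, h₁⟩ := exists_sobolevNormTorus_invPow_osc_le (m + 1)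
    obtain ⟨C₂, h₂⟩ := exists_sobolevNormTorus_succ_le (k := (M + 1) / 2)
      (by obtain ⟨r, rfl⟩ := hM; omega) m
    refine ⟨C₁ * C₂, fun s hs lam hl g => ?_⟩
    simp only [errorNorm, if_neg (Nat.not_even_iff_odd.2 hM), ← coe_invPow]
    refine (h₁ _ s hs lam hl g).trans ((mul_le_mul_right (h₂ s hs g) _).trans_eq ?_)
    have e : -(2 * ((M + 1) / 2 : ℕ) : ℤ) + ((m + 1 : ℕ) : ℤ) = -(M : ℤ) + m := by
      obtain ⟨r, rfl⟩ := hM; omega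
    rw [e]
    push_cast
    ring

end bounds

theorem mainTheorem5 (N M : ℕ) :
    ∃ B V : TestFun →ₗ[ℝ] PeriodicMeanZero →ₗ[ℝ] TestFun,
      -- the identity `Δ^N B(f,g) = f g + V(f,g)`
      (∀ (f : TestFun) (g : PeriodicMeanZero) (x : Plane),
        (lap^[N] (B f g : Plane → ℝ)) x =
          (f : Plane → ℝ) x * (g : Plane → ℝ) x + (V f g : Plane → ℝ) x) ∧
      -- supports
      (∀ (f : TestFun) (g : PeriodicMeanZero),
        tsupport (B f g : Plane → ℝ) ⊆ tsupport (f : Plane → ℝ) ∧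
        tsupport (V f g : Plane → ℝ) ⊆ tsupport (f : Plane → ℝ)) ∧
      -- Leibniz rule in time, for smooth `f, g` on a nondegenerate time interval `I`
      -- with time derivatives `f', g'`
      (∀ (I : Set ℝ), I.OrdConnected → I.Nontrivial →
        ∀ (f f' : ℝ → TestFun) (g g' : ℝ → PeriodicMeanZero),
        ContDiffOn ℝ ∞ (fun p : ℝ × Plane => (f p.1 : Plane → ℝ) p.2) (I ×ˢ Set.univ) →
        ContDiffOn ℝ ∞ (fun p : ℝ × Plane => (g p.1 : Plane → ℝ) p.2) (I ×ˢ Set.univ) →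
        (∀ t ∈ I, ∀ x : Plane,
          HasDerivWithinAt (fun τ => (f τ : Plane → ℝ) x) ((f' t : Plane → ℝ) x) I t) →
        (∀ t ∈ I, ∀ x : Plane,
          HasDerivWithinAt (fun τ => (g τ : Plane → ℝ) x) ((g' t : Plane → ℝ) x) I t) →
        ∀ t ∈ I, ∀ x : Plane,
          HasDerivWithinAt (fun τ => (B (f τ) (g τ) : Plane → ℝ) x)
            ((B (f' t) (g t) : Plane → ℝ) x + (B (f t) (g' t) : Plane → ℝ) x) I t ∧
          HasDerivWithinAt (fun τ => (V (f τ) (g τ) : Plane → ℝ) x)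
            ((V (f' t) (g t) : Plane → ℝ) x + (V (f t) (g' t) : Plane → ℝ) x) I t) ∧
      -- estimates, for `f` supported in a ball of radius `R`
      (∀ m : ℕ, ∃ C : ℝ≥0, ∀ s : ℝ≥0∞, 1 ≤ s →
        ∀ (f : TestFun) (x₀ : Plane) (R : ℝ), 0 ≤ R →
        tsupport (f : Plane → ℝ) ⊆ Metric.closedBall x₀ R →
        ∀ g : PeriodicMeanZero,
          sobolevNormPlane m s (B f g : Plane → ℝ) ≤
            C * ENNReal.ofReal (1 + R) ^ (2 / s).toReal * cNorm (2 * N * M + m) (f : Plane → ℝ) *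
              sobolevNormTorus m s (invLap N (g : Plane → ℝ)) ∧
          sobolevNormPlane m s (V f g : Plane → ℝ) ≤
            C * ENNReal.ofReal (1 + R) ^ (2 / s).toReal *
              cNorm (2 * N * (M + 1) + m) (f : Plane → ℝ) *
              (if Even M then sobolevNormTorus m s (invLap (M / 2) (g : Plane → ℝ))
                else sobolevNormTorus (m + 1) s (invLap ((M + 1) / 2) (g : Plane → ℝ))) ∧
          -- fast oscillating second argument
          ∀ (lam : ℕ) (hlam : 1 ≤ lam),
            sobolevNormPlane m s (B f (osc lam hlam g) : Plane → ℝ) ≤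
              C * ENNReal.ofReal (1 + R) ^ (2 / s).toReal *
                (lam : ℝ≥0∞) ^ (-(2 * N : ℤ) + (m : ℤ)) * cNorm (2 * N * M + m) (f : Plane → ℝ) *
                sobolevNormTorus m s (invLap N (g : Plane → ℝ)) ∧
            sobolevNormPlane m s (V f (osc lam hlam g) : Plane → ℝ) ≤
              C * ENNReal.ofReal (1 + R) ^ (2 / s).toReal *
                (lam : ℝ≥0∞) ^ (-(M : ℤ) + (m : ℤ)) *
                cNorm (2 * N * (M + 1) + m) (f : Plane → ℝ) *
                sobolevNormTorus m s (g : Plane → ℝ)) := by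
  obtain ⟨B, hB, V, hV, e⟩ := exists_bilinear_operators N M
  have hVorder : 2 * N * (M + 1) - M ≤ 2 * (N * (M + 1)) := by rw [← mul_assoc]; omega
  refine ⟨B, V, fun f g x => ?_, fun f g => ⟨?_, ?_⟩,
    fun I hI hn f f' g g' hf hg hf' hg' t ht x => ⟨?_, ?_⟩, fun m => ?_⟩
  · rw [← coe_postLap_pow, e]
    rfl
  · refine tsupport_subset_of_mem_span ?_ hB
    rintro _ ⟨a, b, k, -, -, rfl⟩
    exact tsupport_elem_subset ..
  · refine tsupport_subset_of_mem_span ?_ hV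
    rintro _ ⟨a, b, -, -, rfl⟩
    exact tsupport_elem_subset ..
  · refine timeLeibniz_of_mem_span ?_ hB I hI hn f f' g g' hf hg hf' hg' t ht x
    rintro _ ⟨a, b, k, -, hb, rfl⟩
    rcases hb with hb | ⟨rfl, rfl⟩
    · exact timeLeibniz_elem (Or.inl (by omega))
    · exact timeLeibniz_elem (by simp; omega)
  · refine timeLeibniz_of_mem_span ?_ hV I hI hn f f' g g' hf hg hf' hg' t ht x
    rintro _ ⟨a, b, -, hb, rfl⟩
    exact timeLeibniz_elem (Or.inl (hb.trans_le hVorder))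
  · obtain ⟨C₁, h₁⟩ := sobolevBound_of_mem_mainSpan hB m
    obtain ⟨C₂, h₂⟩ := sobolevBound_error hV m
    obtain ⟨C₃, h₃⟩ := exists_sobolevNormTorus_invPow_osc_le m
    obtain ⟨C₄, h₄⟩ := exists_errorNorm_osc_le M m
    -- a common constant for the four bounds
    set C : ℝ≥0 := C₁ + C₂ + C₁ * C₃ + C₂ * C₄
    have hC₁ : (C₁ : ℝ≥0∞) ≤ C := by
      exact_mod_cast (le_self_add.trans le_self_add).trans le_self_add
    have hC₂ : (C₂ : ℝ≥0∞) ≤ C := by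
      exact_mod_cast (le_add_self.trans le_self_add).trans le_self_add
    have hC₃ : (C₁ : ℝ≥0∞) * C₃ ≤ C := by exact_mod_cast le_add_self.trans le_self_add
    have hC₄ : (C₂ : ℝ≥0∞) * C₄ ≤ C := by exact_mod_cast le_add_self
    refine ⟨C, fun s hs f x₀ R hR hf g => ⟨?_, ?_, fun lam hlam => ⟨?_, ?_⟩⟩⟩
    · refine (h₁ s hs f x₀ R hR hf g).trans ?_
      simp only [coe_invPow]
      gcongr
    · refine (h₂ s hs f x₀ R hR hf g).trans ?_
      unfold errorNorm
      gcongr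
    · refine (h₁ s hs f x₀ R hR hf _).trans ((mul_le_mul_right (h₃ N s hs lam hlam g) _).trans ?_)
      simp only [coe_invPow]
      calc _ = (C₁ * C₃ : ℝ≥0∞) * ENNReal.ofReal (1 + R) ^ (2 / s).toReal *
            (lam : ℝ≥0∞) ^ (-(2 * N : ℤ) + (m : ℤ)) * cNorm (2 * N * M + m) (f : Plane → ℝ) *
            sobolevNormTorus m s (invLap N (g : Plane → ℝ)) := by ring
        _ ≤ _ := by gcongr
    · refine (h₂ s hs f x₀ R hR hf _).trans ((mul_le_mul_right (h₄ s hs lam hlam g) _).trans ?_)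
      calc _ = (C₂ * C₄ : ℝ≥0∞) * ENNReal.ofReal (1 + R) ^ (2 / s).toReal *
            (lam : ℝ≥0∞) ^ (-(M : ℤ) + (m : ℤ)) *
            cNorm (2 * N * (M + 1) + m) (f : Plane → ℝ) *
            sobolevNormTorus m s (g : Plane → ℝ) := by ring
        _ ≤ _ := by gcongr
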